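/- Let $n,m,r$ be non-negative integers with $m+r\le n+1$. Let $\lambda=(n,n-1,\dots,1)$ and let $\mu=(m^r)=(m,\dots,m,0,\dots,0)$ ($r$ copies of $m$), padded with zeros to an $n$-tuple (if $r=n+1$, then $m=0$ and $\mu=(0,\dots,0)$). A standard Young tableau of skew shape $\lambda/\mu$ is a filling of the cells $(i,j)$, $1\le i\le n$, $\mu_i<j\le\lambda_i$, with the numbers $1,2,\dots,|\lambda-\mu|=\binom{n+1}{2}-mr$, each used exactly once, that is increasing along rows (from left to right) and down columns (rows being numbered from top to bottom). The major index $\operatorname{maj}(T)$ of such a tableau $T$ is the sum of all $i$ such that $i+1$ appears in a lower row of $T$ than $i$. Write $[a]_q=1+q+\dots+q^{a-1}$ and $[a]_q!=[a]_q[a-1]_q\cdots[1]_q$, with $[0]_q!=1$. Then, as an identity of rational functions in $q$, $$ \sum_T q^{\operatorname{maj}(T)} = q^{\frac12 mr(r+m-2n)+\binom{n+1}{3}}\,(1+q)^{\binom n2-mr}\, \Big[\tbinom{n+1}{2}-mr\Big]_q!\; \prod_{i=1}^{n}\frac{[i-1]_{q^2}!}{[2i-1]_q!}\; \prod_{i=1}^{r}\frac{[i-1]_{q^2}!\,[n+m-r+2i-1]_q!}{[m+i-1]_{q^2}!\,[n-m-r+2i-1]_q!},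 $$ where the sum runs over all standard Young tableaux $T$ of shape $(n,n-1,\dots,1)/(m^r)$. -/

import Mathlib

open Finset

/-- The cells `(i, j)` of the skew diagram `lam / mu`, where `lam` and `mu` are `n`-tuples of
non-negative integers. The rows are numbered from top to bottom by `Fin n`; the columns are numbered
from left to right by positive integers, so that row `i` consists of the columns
`mu i + 1, …, lam i`. -/
def skewCells {n : ℕ} (lam mu : Fin n → ℕ) : Finset (Fin n × ℕ) :=
  (univ : Finset (Fin n)).biUnion fun i => (Ioc (mu i) (lam i)).image fun j => (i, j)

/-- The size `|lam - mu|`. -/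
def skewSize {n : ℕ} (lam mu : Fin n → ℕ) : ℕ :=
  ∑ i, (lam i - mu i)

/-- Standard Young tableaux of skew shape `lam / mu`: bijective fillings of the cells with the
numbers `1, 2, …, |lam - mu|` that increase along rows and down columns. -/
def SkewSYT {n : ℕ} (lam mu : Fin n → ℕ) : Type :=
  {T : skewCells lam mu ≃ Icc 1 (skewSize lam mu) //
    (∀ c d : skewCells lam mu, c.1.1 = d.1.1 → c.1.2 < d.1.2 → (T c : ℕ) < T d) ∧
    (∀ c d : skewCells lam mu, c.1.2 = d.1.2 → c.1.1 < d.1.1 → (T c : ℕ) < T d)}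

noncomputable instance {n : ℕ} (lam mu : Fin n → ℕ) : Fintype (SkewSYT lam mu) := by
  classical
  unfold SkewSYT
  infer_instance

open Classical in
/-- The major index of a standard Young tableau `T`: the sum of all `i` such that `i + 1` appears
in a lower row of `T` than `i`. -/
noncomputable def SkewSYT.maj {n : ℕ} {lam mu : Fin n → ℕ} (T : SkewSYT lam mu) : ℕ :=
  ∑ i ∈ (Icc 1 (skewSize lam mu)).filter (fun i =>
    ∃ c d : skewCells lam mu, (T.1 c : ℕ) = i ∧ (T.1 d : ℕ) = i + 1 ∧ c.1.1 < d.1.1), i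

/-- The staircase `(n, n - 1, …, 1)`. -/
def staircase (n : ℕ) : Fin n → ℕ := fun i => n - i

/-- The rectangle `(m ^ r) = (m, …, m, 0, …, 0)`, padded with zeros to an `n`-tuple. -/
def rectangle (n m r : ℕ) : Fin n → ℕ := fun i => if (i : ℕ) < r then m else 0

/-- The `q`-integer `[a]_q = 1 + q + ⋯ + q ^ (a - 1)`. -/
def qInteger {K : Type*} [Field K] (q : K) (a : ℕ) : K :=
  ∑ k ∈ range a, q ^ k

/-- The `q`-factorial `[a]_q! = [a]_q [a - 1]_q ⋯ [1]_q`. -/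
def qFactorial {K : Type*} [Field K] (q : K) (a : ℕ) : K :=
  ∏ k ∈ Icc 1 a, qInteger q k

/-! The sum over tableaux is turned into a determinant, and the determinant is then evaluated.

For any skew shape with N cells the major index generating function is `(q; q)_N` times the
Jacobi-Trudi determinant with entries `1 / (q; q)_a` (`majSum_eq_det`). The induction removes the
largest entry. Whether N is a descent depends on the row of a hypothetical next entry, so a
threshold `t` is carried along: N also counts if it lies above row `t`. On the determinant side the
first `t` rows use the alphabet `q, q ^ 2, …` instead of `1, q, …`. Both sides then satisfy the same
recursion, since `q ^ a / (q; q)_a = 1 / (q; q)_a - 1 / (q; q)_(a - 1)`.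

For the staircase minus a rectangle, reversing rows and columns gives entries `1 / (q; q)_(2i + 1 -
c_j)`, where `c_j = j` for `j < s = n - r` and `c_j = j + m` otherwise. Up to a row factor each
entry is a polynomial in `x = q ^ (2i + 1)`. Its expansion in the Newton basis at the odd powers of
`q` has closed-form coefficients (`prod_one_sub_eq_sum_newtonCoeff`). Hence the matrix is diagonal
times lower triangular times a coefficient matrix. The latter is block triangular: one block is
triangular, the other falls to Krattenthaler's lemma (`det_prod_sub_mul_prod_sub`). What remains is
collecting powers of `q` and `1 - q`. -/

/-! ### `q`-Pochhammer symbols and their reciprocals. -/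

/-- The `q`-Pochhammer symbol `(q; q)_a`. -/
def poch {K : Type*} [Field K] (q : K) (a : ℕ) : K :=
  ∏ k ∈ range a, (1 - q ^ (k + 1))

/-- The reciprocal `1 / (q; q)_a`, extended by zero to negative `a`. -/
def invPoch {K : Type*} [Field K] (q : K) (a : ℤ) : K :=
  if a < 0 then 0 else (poch q a.toNat)⁻¹

lemma poch_zero {K : Type*} [Field K] (q : K) : poch q 0 = 1 := by simp [poch]

lemma poch_succ {K : Type*} [Field K] (q : K) (a : ℕ) :
    poch q (a + 1) = poch q a * (1 - q ^ (a + 1)) := by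
  simp [poch, prod_range_succ]

lemma poch_ne_zero {K : Type*} [Field K] {q : K} (hq : ∀ k : ℕ, 1 - q ^ (k + 1) ≠ 0) (a : ℕ) :
    poch q a ≠ 0 :=
  prod_ne_zero_iff.2 fun k _ => hq k

lemma invPoch_of_neg {K : Type*} [Field K] (q : K) {a : ℤ} (ha : a < 0) : invPoch q a = 0 :=
  if_pos ha

lemma invPoch_natCast {K : Type*} [Field K] (q : K) (a : ℕ) :
    invPoch q (a : ℤ) = (poch q a)⁻¹ := by
  simp [invPoch]

/-- Extending by zero keeps the recurrence valid for every integer: at `a = 0` the factor `1 - q ^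
a` vanishes. No boundary cases arise later. -/
lemma invPoch_sub_one {K : Type*} [Field K] {q : K} (hq : ∀ k : ℕ, 1 - q ^ (k + 1) ≠ 0) (a : ℤ) :
    invPoch q (a - 1) = (1 - q ^ a) * invPoch q a := by
  rcases lt_trichotomy a 0 with ha | rfl | ha
  · rw [invPoch_of_neg q ha, invPoch_of_neg q (by omega), mul_zero]
  · rw [invPoch_of_neg q (by omega)]
    simp
  · obtain ⟨b, rfl⟩ : ∃ b : ℕ, a = (b : ℤ) + 1 := ⟨(a - 1).toNat, by omega⟩
    have h1 : invPoch q ((b : ℤ) + 1) = (poch q (b + 1))⁻¹ := by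
      rw [← invPoch_natCast]; push_cast; rfl
    have h2 : q ^ ((b : ℤ) + 1) = q ^ (b + 1) := by
      rw [← zpow_natCast]; push_cast; rfl
    rw [add_sub_cancel_right, h1, h2, invPoch_natCast, poch_succ]
    have := hq b
    have := poch_ne_zero hq b
    field_simp

/-! ### Jacobi-Trudi determinants with a row threshold. -/

/-- The Jacobi-Trudi matrix of shape `l / mu` at the specialization `1, q, q ^ 2, …`, in which the
first `t` rows are specialized at `q, q ^ 2, …` instead. -/
def jacobiTrudi {K : Type*} [Field K] (q : K) {n : ℕ} (t : ℕ) (l mu : Fin n → ℤ) :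
    Matrix (Fin n) (Fin n) K :=
  Matrix.of fun i j => (if (i : ℕ) < t then q ^ (l i - i - mu j + j) else 1) *
    invPoch q (l i - i - mu j + j)

/-- Linearity in row `i`: by `invPoch_sub_one`, `q ^ a / (q; q)_a` is the entry at `a` minus the
entry at `a - 1`, and lowering `a` along the row means shortening `l i`. -/
lemma det_jacobiTrudi_succ {K : Type*} [Field K] {q : K}
    (hq : ∀ k : ℕ, 1 - q ^ (k + 1) ≠ 0) {n : ℕ} (i : Fin n) (l mu : Fin n → ℤ) :
    (jacobiTrudi q (i + 1) l mu).det =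
      (jacobiTrudi q i l mu).det - (jacobiTrudi q i (Function.update l i (l i - 1)) mu).det := by
  have h1 : jacobiTrudi q (i + 1) l mu = (jacobiTrudi q i l mu).updateRow i
      (jacobiTrudi q i l mu i +
        (-1 : K) • jacobiTrudi q i (Function.update l i (l i - 1)) mu i) := by
    ext a b
    by_cases hab : a = i
    · subst hab
      have := invPoch_sub_one hq (l a - a - mu b + b)
      have e : l a - 1 - a - mu b + b = l a - a - mu b + b - 1 := by ring
      simp [jacobiTrudi, e, this]
      ring
    · have : (a : ℕ) < i + 1 ↔ (a : ℕ) < i := by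
        have : (a : ℕ) ≠ i := fun h => hab (Fin.ext h)
        omega
      simp only [jacobiTrudi, Matrix.updateRow_ne hab, this, Matrix.of_apply]
  have h2 : jacobiTrudi q i (Function.update l i (l i - 1)) mu =
      (jacobiTrudi q i l mu).updateRow i
        (jacobiTrudi q i (Function.update l i (l i - 1)) mu i) := by
    ext a b
    by_cases hab : a = i
    · subst hab
      simp
    · simp [jacobiTrudi, hab]
  rw [h1, Matrix.det_updateRow_add, Matrix.det_updateRow_smul, Matrix.updateRow_eq_self, ← h2]
  ring

lemma det_jacobiTrudi_eq_sub_sum {K : Type*} [Field K] {q : K}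
    (hq : ∀ k : ℕ, 1 - q ^ (k + 1) ≠ 0) {n : ℕ} (t : ℕ) (ht : t ≤ n) (l mu : Fin n → ℤ) :
    (jacobiTrudi q t l mu).det = (jacobiTrudi q 0 l mu).det -
      ∑ i : Fin n, if (i : ℕ) < t then
        (jacobiTrudi q i (Function.update l i (l i - 1)) mu).det else 0 := by
  induction t with
  | zero => simp
  | succ t ih =>
    have h := det_jacobiTrudi_succ hq ⟨t, ht⟩ l mu
    simp only at h
    rw [h, ih (by omega), sub_sub]
    congr 1
    rw [← Finset.sum_erase_add _ _ (mem_univ (⟨t, ht⟩ : Fin n)),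
      ← Finset.sum_erase_add univ (fun i : Fin n => if (i : ℕ) < t + 1 then _ else 0)
        (mem_univ (⟨t, ht⟩ : Fin n))]
    simp only [lt_self_iff_false, if_false, add_zero, Nat.lt_succ_self, if_true]
    congr 1
    refine sum_congr rfl fun i hi => ?_
    have : (i : ℕ) ≠ t := fun h => (mem_erase.1 hi).1 (Fin.ext h)
    have : (i : ℕ) < t + 1 ↔ (i : ℕ) < t := by omega
    simp [this]

/-- Homogeneity: the exponent in each entry is a row term plus a column term, so the powers of `q`
factor out of rows and columns. -/
lemma det_jacobiTrudi_last {K : Type*} [Field K] {q : K} (hq0 : q ≠ 0) {n : ℕ}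
    (l mu : Fin n → ℤ) :
    (jacobiTrudi q n l mu).det = q ^ (∑ i, (l i - mu i)) * (jacobiTrudi q 0 l mu).det := by
  have h : jacobiTrudi q n l mu = Matrix.of fun (i j : Fin n) => q ^ (l i - (i : ℤ)) *
      (Matrix.of fun (i j : Fin n) => q ^ ((j : ℤ) - mu j) * jacobiTrudi q 0 l mu i j) i j := by
    ext i j
    have e : l i - i - mu j + j = (l i - (i : ℤ)) + ((j : ℤ) - mu j) := by ring
    simp only [jacobiTrudi, Matrix.of_apply, i.2, if_true, Nat.not_lt_zero, if_false, one_mul]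
    rw [← mul_assoc, ← zpow_add₀ hq0, e]
  have hprod : ∀ (s : Finset (Fin n)) (f : Fin n → ℤ), ∏ i ∈ s, q ^ f i = q ^ ∑ i ∈ s, f i := by
    intro s f
    induction s using Finset.cons_induction with
    | empty => simp
    | cons a s ha ih => rw [prod_cons, sum_cons, zpow_add₀ hq0, ih]
  rw [h, Matrix.det_mul_column, Matrix.det_mul_row, hprod, hprod, ← mul_assoc, ← zpow_add₀ hq0,
    ← sum_add_distrib]
  congr 2
  exact sum_congr rfl fun i _ => by ring

/-- Shortening row `i` makes it equal to the next row. The threshold `i` matters: both rows lie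
beyond it and so use the same alphabet. -/
lemma det_jacobiTrudi_eq_zero_of_eq {K : Type*} [Field K] (q : K) {n : ℕ} (i i' : Fin n)
    (hi : (i' : ℕ) = i + 1) (l mu : Fin n → ℤ) (hl : l i = l i') :
    (jacobiTrudi q i (Function.update l i (l i - 1)) mu).det = 0 := by
  have hne : i' ≠ i := fun h => by rw [h] at hi; omega
  refine Matrix.det_zero_of_row_eq hne.symm ?_
  ext j
  have e : l i - 1 - i - mu j + j = l i' - i' - mu j + j := by rw [hl, hi]; push_cast; ring
  have : ¬ (i' : ℕ) < i := by omega
  simp only [jacobiTrudi, Matrix.of_apply, Function.update_self, Function.update_of_ne hne, e,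
    this, lt_self_iff_false, if_false]

/-- Pigeonhole: a permutation cannot send the `i + 1` indices up to `i` into the `i` indices below
`i`, so every term of the expansion meets the zero block. -/
lemma Matrix.det_eq_zero_of_zero_block {R : Type*} [CommRing R] {n : ℕ} (M : Matrix (Fin n) (Fin n) R)
    (i : Fin n) (h : ∀ j k, i ≤ j → k ≤ i → M j k = 0) : M.det = 0 := by
  rw [Matrix.det_apply]
  refine sum_eq_zero fun σ _ => ?_
  obtain ⟨k, hk, hσ⟩ : ∃ k, k ≤ i ∧ i ≤ σ k := by
    by_contra! hcon
    have := card_le_card_of_injOn (s := Iic i) (t := Iio i) σ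
      (fun k hk => by simpa using hcon k (by simpa using hk)) σ.injective.injOn
    simp at this
  rw [prod_eq_zero (f := fun k => M (σ k) k) (mem_univ k) (h _ _ hσ hk), smul_zero]

lemma det_jacobiTrudi_eq_zero_of_le {K : Type*} [Field K] (q : K) {n : ℕ} (t : ℕ) (i : Fin n)
    (l mu : Fin n → ℤ) (hl : Antitone l) (hmu : Antitone mu) (hi : l i = mu i) :
    (jacobiTrudi q t (Function.update l i (l i - 1)) mu).det = 0 := by
  refine Matrix.det_eq_zero_of_zero_block _ i fun j k hj hk => ?_
  have h1 := hmu hk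
  have h2 : (k : ℕ) ≤ i := hk
  have h3 : (i : ℕ) ≤ j := hj
  have h4 := hl hj
  simp only [jacobiTrudi, Matrix.of_apply]
  rw [invPoch_of_neg, mul_zero]
  rcases eq_or_ne j i with rfl | hne
  · simp only [Function.update_self]; omega
  · have : (j : ℕ) ≠ i := fun h => hne (Fin.ext h)
    simp only [Function.update_of_ne hne]; omega

lemma det_jacobiTrudi_self {K : Type*} [Field K] (q : K) {n : ℕ} (t : ℕ)
    (mu : Fin n → ℤ) (hmu : Antitone mu) : (jacobiTrudi q t mu mu).det = 1 := by
  rw [Matrix.det_of_isUpperTriangular]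
  · refine prod_eq_one fun i _ => ?_
    simp [jacobiTrudi, invPoch, poch]
  · intro i j hij
    have h1 : (j : ℕ) < i := hij
    have h2 := hmu (le_of_lt hij : j ≤ i)
    simp only [jacobiTrudi, Matrix.of_apply]
    rw [invPoch_of_neg, mul_zero]
    omega

/-! ### Tableaux as functions on a fixed domain, where deleting or adding a cell is a
`Function.update`. -/

lemma mem_skewCells {n : ℕ} {lam mu : Fin n → ℕ} {c : Fin n × ℕ} :
    c ∈ skewCells lam mu ↔ mu c.1 < c.2 ∧ c.2 ≤ lam c.1 := by
  obtain ⟨i, j⟩ := c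
  simp [skewCells]

/-- Standard Young tableaux as functions on all of `Fin n × ℕ` that vanish off the diagram. -/
structure IsSYT {n : ℕ} (lam mu : Fin n → ℕ) (f : Fin n × ℕ → ℕ) : Prop where
  ne_zero_iff : ∀ c, f c ≠ 0 ↔ c ∈ skewCells lam mu
  le_size : ∀ c, f c ≤ skewSize lam mu
  inj : ∀ c d, f c ≠ 0 → f c = f d → c = d
  surj : ∀ k, 1 ≤ k → k ≤ skewSize lam mu → ∃ c, f c = k
  row : ∀ i j j', f (i, j) ≠ 0 → f (i, j') ≠ 0 → j < j' → f (i, j) < f (i, j')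
  col : ∀ i i' j, f (i, j) ≠ 0 → f (i', j) ≠ 0 → i < i' → f (i, j) < f (i', j)

open Classical in
/-- Extension of a tableau by zero. -/
noncomputable def SkewSYT.extend {n : ℕ} {lam mu : Fin n → ℕ} (T : SkewSYT lam mu)
    (c : Fin n × ℕ) : ℕ :=
  if h : c ∈ skewCells lam mu then (T.1 ⟨c, h⟩ : ℕ) else 0

open Classical in
/-- The finite set of all standard Young tableaux, as functions. -/
noncomputable def sytFinset {n : ℕ} (lam mu : Fin n → ℕ) : Finset (Fin n × ℕ → ℕ) :=
  (univ : Finset (SkewSYT lam mu)).image SkewSYT.extend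

open Classical in
/-- The major index of a tableau given by a function, with `N` entries. -/
noncomputable def majFun {n : ℕ} (N : ℕ) (f : Fin n × ℕ → ℕ) : ℕ :=
  ∑ i ∈ (Icc 1 N).filter (fun i => ∃ c d, f c = i ∧ f d = i + 1 ∧ c.1 < d.1), i

lemma SkewSYT.extend_apply {n : ℕ} {lam mu : Fin n → ℕ} (T : SkewSYT lam mu)
    (c : skewCells lam mu) : T.extend c.1 = T.1 c := by
  simp [SkewSYT.extend]

lemma SkewSYT.extend_ne_zero {n : ℕ} {lam mu : Fin n → ℕ} (T : SkewSYT lam mu)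
    (c : Fin n × ℕ) : T.extend c ≠ 0 ↔ c ∈ skewCells lam mu := by
  by_cases h : c ∈ skewCells lam mu
  · have := (mem_Icc.1 (T.1 ⟨c, h⟩).2).1
    simp only [SkewSYT.extend, h, dif_pos, iff_true]
    omega
  · simp [SkewSYT.extend, h]

lemma SkewSYT.extend_injective {n : ℕ} {lam mu : Fin n → ℕ} :
    Function.Injective (SkewSYT.extend (lam := lam) (mu := mu)) := by
  intro T T' h
  refine Subtype.ext (Equiv.ext fun c => Subtype.ext ?_)
  rw [← T.extend_apply, ← T'.extend_apply, h]

lemma SkewSYT.isSYT_extend {n : ℕ} {lam mu : Fin n → ℕ} (T : SkewSYT lam mu) :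
    IsSYT lam mu T.extend where
  ne_zero_iff := T.extend_ne_zero
  le_size c := by
    by_cases h : c ∈ skewCells lam mu
    · have := (mem_Icc.1 (T.1 ⟨c, h⟩).2).2
      simpa only [SkewSYT.extend, h, dif_pos] using this
    · simp [SkewSYT.extend, h]
  inj c d hc hcd := by
    have hd : T.extend d ≠ 0 := hcd ▸ hc
    rw [T.extend_ne_zero] at hc hd
    rw [T.extend_apply ⟨c, hc⟩, T.extend_apply ⟨d, hd⟩] at hcd
    exact congrArg Subtype.val (T.1.injective (Subtype.ext hcd))
  surj k h1 h2 := by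
    refine ⟨(T.1.symm ⟨k, mem_Icc.2 ⟨h1, h2⟩⟩).1, ?_⟩
    rw [T.extend_apply]
    simp
  row i j j' h1 h2 h := by
    rw [T.extend_ne_zero] at h1 h2
    rw [T.extend_apply ⟨_, h1⟩, T.extend_apply ⟨_, h2⟩]
    exact T.2.1 _ _ rfl h
  col i j j' h1 h2 h := by
    rw [T.extend_ne_zero] at h1 h2
    rw [T.extend_apply ⟨_, h1⟩, T.extend_apply ⟨_, h2⟩]
    exact T.2.2 _ _ rfl h

lemma mem_sytFinset {n : ℕ} {lam mu : Fin n → ℕ} {f : Fin n × ℕ → ℕ} :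
    f ∈ sytFinset lam mu ↔ IsSYT lam mu f := by
  classical
  simp only [sytFinset, mem_image, mem_univ, true_and]
  constructor
  · rintro ⟨T, rfl⟩
    exact T.isSYT_extend
  · intro hf
    have hmem : ∀ c : skewCells lam mu, f c.1 ∈ Icc 1 (skewSize lam mu) := fun c =>
      mem_Icc.2 ⟨Nat.one_le_iff_ne_zero.2 ((hf.ne_zero_iff _).2 c.2), hf.le_size _⟩
    have hbij : Function.Bijective
        (fun c : skewCells lam mu => (⟨f c.1, hmem c⟩ : Icc 1 (skewSize lam mu))) := by
      constructor
      · intro c d h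
        exact Subtype.ext (hf.inj _ _ ((hf.ne_zero_iff _).2 c.2) (congrArg Subtype.val h))
      · rintro ⟨k, hk⟩
        obtain ⟨h1, h2⟩ := mem_Icc.1 hk
        obtain ⟨c, hc⟩ := hf.surj k h1 h2
        exact ⟨⟨c, (hf.ne_zero_iff c).1 (by omega)⟩, Subtype.ext hc⟩
    refine ⟨⟨Equiv.ofBijective _ hbij, ?_, ?_⟩, ?_⟩
    · rintro ⟨⟨i, j⟩, hc⟩ ⟨⟨i', j'⟩, hd⟩ h1 h2
      simp only at h1
      subst h1
      exact hf.row _ _ _ ((hf.ne_zero_iff _).2 hc) ((hf.ne_zero_iff _).2 hd) h2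
    · rintro ⟨⟨i, j⟩, hc⟩ ⟨⟨i', j'⟩, hd⟩ h1 h2
      simp only at h1
      subst h1
      exact hf.col _ _ _ ((hf.ne_zero_iff _).2 hc) ((hf.ne_zero_iff _).2 hd) h2
    · funext c
      by_cases hc : c ∈ skewCells lam mu
      · simp [SkewSYT.extend, hc]
      · simp only [SkewSYT.extend, hc, dif_neg, not_false_eq_true]
        by_contra h
        exact hc ((hf.ne_zero_iff c).1 (Ne.symm h))

lemma SkewSYT.majFun_extend {n : ℕ} {lam mu : Fin n → ℕ} (T : SkewSYT lam mu) :
    majFun (skewSize lam mu) T.extend = T.maj := by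
  classical
  refine sum_congr (filter_congr fun i hi => ?_) fun _ _ => rfl
  have h1 := (mem_Icc.1 hi).1
  constructor
  · rintro ⟨c, d, hc, hd, h⟩
    have hc' := (T.extend_ne_zero c).1 (by omega)
    have hd' := (T.extend_ne_zero d).1 (by omega)
    exact ⟨⟨c, hc'⟩, ⟨d, hd'⟩, by rw [← T.extend_apply]; exact hc,
      by rw [← T.extend_apply]; exact hd, h⟩
  · rintro ⟨c, d, hc, hd, h⟩
    exact ⟨c.1, d.1, by rw [T.extend_apply, hc], by rw [T.extend_apply, hd], h⟩

lemma sum_skewSYT {K : Type*} [Field K] (q : K) {n : ℕ} (lam mu : Fin n → ℕ) :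
    ∑ T : SkewSYT lam mu, q ^ T.maj =
      ∑ f ∈ sytFinset lam mu, q ^ majFun (skewSize lam mu) f := by
  classical
  rw [sytFinset, sum_image SkewSYT.extend_injective.injOn]
  simp only [SkewSYT.majFun_extend]

/-! ### Removing and adding the largest entry. -/

lemma skewSize_update {n : ℕ} {lam mu : Fin n → ℕ} {i : Fin n} (hi : mu i < lam i) :
    skewSize lam mu = skewSize (Function.update lam i (lam i - 1)) mu + 1 := by
  unfold skewSize
  rw [← sum_erase_add _ _ (mem_univ i), ← sum_erase_add _ _ (mem_univ i), Function.update_self]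
  have : ∑ x ∈ univ.erase i, (Function.update lam i (lam i - 1) x - mu x) =
      ∑ x ∈ univ.erase i, (lam x - mu x) :=
    sum_congr rfl fun x hx => by rw [Function.update_of_ne (mem_erase.1 hx).1]
  omega

lemma mem_skewCells_update {n : ℕ} {lam mu : Fin n → ℕ} {i : Fin n} (hi : mu i < lam i)
    (c : Fin n × ℕ) :
    c ∈ skewCells (Function.update lam i (lam i - 1)) mu ↔
      c ∈ skewCells lam mu ∧ c ≠ (i, lam i) := by
  obtain ⟨a, b⟩ := c
  rw [mem_skewCells, mem_skewCells]
  by_cases h : a = i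
  · subst h
    simp
    omega
  · simp [h]

namespace IsSYT

variable {n : ℕ} {lam mu : Fin n → ℕ} {f : Fin n × ℕ → ℕ} {i : Fin n}

lemma lt_of_last (hf : IsSYT lam mu f) (hN : skewSize lam mu ≠ 0)
    (hi : f (i, lam i) = skewSize lam mu) : mu i < lam i :=
  (mem_skewCells.1 ((hf.ne_zero_iff (i, lam i)).1 (by omega))).1

lemma exists_last (hf : IsSYT lam mu f) (hN : skewSize lam mu ≠ 0) :
    ∃ i, f (i, lam i) = skewSize lam mu := by
  obtain ⟨⟨i, j⟩, h⟩ := hf.surj _ (Nat.one_le_iff_ne_zero.2 hN) le_rfl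
  have hc := mem_skewCells.1 ((hf.ne_zero_iff (i, j)).1 (by omega))
  simp only at hc
  refine ⟨i, ?_⟩
  rcases eq_or_lt_of_le hc.2 with h1 | h1
  · rw [← h1, h]
  · have h2 := hf.row i j (lam i) (by omega)
      ((hf.ne_zero_iff _).2 (mem_skewCells.2 ⟨by simp; omega, le_rfl⟩)) h1
    have := hf.le_size (i, lam i)
    omega

/-- Otherwise row `i'` has a cell in column `lam i`, below the largest entry; `mu` being antitone
ensures that this cell is not cut away. -/
lemma antitone_of_last (hf : IsSYT lam mu f) (hmu : Antitone mu)
    (hN : skewSize lam mu ≠ 0) (hi : f (i, lam i) = skewSize lam mu) {i' : Fin n} (h : i < i') :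
    lam i' < lam i := by
  by_contra! hle
  have h1 := hf.lt_of_last hN hi
  have h2 := hmu h.le
  have h3 := hf.col i i' (lam i) (by omega)
    ((hf.ne_zero_iff _).2 (mem_skewCells.2 ⟨by simp; omega, hle⟩)) h
  have := hf.le_size (i', lam i)
  omega

lemma removeLast (hf : IsSYT lam mu f) (hN : skewSize lam mu ≠ 0)
    (hi : f (i, lam i) = skewSize lam mu) :
    IsSYT (Function.update lam i (lam i - 1)) mu (Function.update f (i, lam i) 0) := by
  have hlt := hf.lt_of_last hN hi
  have hsize := skewSize_update hlt
  have key : ∀ c, Function.update f (i, lam i) 0 c ≠ 0 →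
      Function.update f (i, lam i) 0 c = f c ∧ c ≠ (i, lam i) := by
    intro c hc
    have : c ≠ (i, lam i) := fun h => hc (by rw [h, Function.update_self])
    exact ⟨Function.update_of_ne this _ _, this⟩
  refine ⟨fun c => ?_, fun c => ?_, fun c d hc hcd => ?_, fun k h1 h2 => ?_,
    fun a j j' h1 h2 h => ?_, fun a a' j h1 h2 h => ?_⟩
  · rw [mem_skewCells_update hlt]
    by_cases h : c = (i, lam i)
    · simp [h]
    · rw [Function.update_of_ne h, hf.ne_zero_iff]
      simp [h]
  · by_cases h : c = (i, lam i)
    · simp [h]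
    · rw [Function.update_of_ne h]
      by_contra! hlt'
      have := hf.le_size c
      exact h (hf.inj c (i, lam i) (by omega) (by omega))
  · have h1 := key c hc
    have h2 := key d (hcd ▸ hc)
    exact hf.inj c d (h1.1 ▸ hc) (by rw [← h1.1, ← h2.1, hcd])
  · obtain ⟨c, hc⟩ := hf.surj k h1 (by omega)
    refine ⟨c, ?_⟩
    rw [Function.update_of_ne, hc]
    rintro rfl
    omega
  · obtain ⟨e1, -⟩ := key _ h1
    obtain ⟨e2, -⟩ := key _ h2
    rw [e1] at h1 ⊢
    rw [e2] at h2 ⊢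
    exact hf.row a j j' h1 h2 h
  · obtain ⟨e1, -⟩ := key _ h1
    obtain ⟨e2, -⟩ := key _ h2
    rw [e1] at h1 ⊢
    rw [e2] at h2 ⊢
    exact hf.col a a' j h1 h2 h

lemma addLast (hf : IsSYT (Function.update lam i (lam i - 1)) mu f) (hlt : mu i < lam i)
    (hlam : ∀ i', i < i' → lam i' < lam i) :
    IsSYT lam mu (Function.update f (i, lam i) (skewSize lam mu)) := by
  have hsize := skewSize_update hlt
  have hzero : f (i, lam i) = 0 := by
    by_contra h
    exact ((mem_skewCells_update hlt _).1 ((hf.ne_zero_iff _).1 h)).2 rfl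
  have hle := hf.le_size
  have hcell : ∀ c, f c ≠ 0 → mu c.1 < c.2 ∧ c.2 ≤ lam c.1 := fun c hc =>
    mem_skewCells.1 ((mem_skewCells_update hlt _).1 ((hf.ne_zero_iff _).1 hc)).1
  refine ⟨fun c => ?_, fun c => ?_, fun c d hc hcd => ?_, fun k h1 h2 => ?_,
    fun a j j' h1 h2 h => ?_, fun a a' j h1 h2 h => ?_⟩
  · by_cases h : c = (i, lam i)
    · subst h
      rw [Function.update_self, mem_skewCells]
      simp only [le_refl, and_true]
      omega
    · rw [Function.update_of_ne h, hf.ne_zero_iff, mem_skewCells_update hlt]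
      simp [h]
  · have := hle c
    by_cases h : c = (i, lam i)
    · simp [h]
    · rw [Function.update_of_ne h]
      omega
  · have h1 := hle c
    have h2 := hle d
    by_cases h : c = (i, lam i) <;> by_cases h' : d = (i, lam i)
    · rw [h, h']
    · rw [h, Function.update_self, Function.update_of_ne h'] at hcd
      omega
    · rw [h', Function.update_self, Function.update_of_ne h] at hcd
      omega
    · rw [Function.update_of_ne h] at hc
      rw [Function.update_of_ne h, Function.update_of_ne h'] at hcd
      exact hf.inj c d hc hcd
  · rcases eq_or_lt_of_le h2 with rfl | h3
    · exact ⟨(i, lam i), Function.update_self ..⟩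
    · obtain ⟨c, hc⟩ := hf.surj k h1 (by omega)
      refine ⟨c, ?_⟩
      rw [Function.update_of_ne, hc]
      rintro rfl
      omega
  · have h3 := hle (a, j)
    by_cases e : (a, j) = (i, lam i) <;> by_cases e' : (a, j') = (i, lam i)
    · simp only [Prod.mk.injEq] at e e'
      omega
    · rw [Function.update_of_ne e'] at h2
      simp only [Prod.mk.injEq] at e
      obtain ⟨rfl, rfl⟩ := e
      have := (hcell _ h2).2
      simp only at this
      omega
    · rw [Function.update_of_ne e, e', Function.update_self]
      omega
    · rw [Function.update_of_ne e] at h1 ⊢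
      rw [Function.update_of_ne e'] at h2 ⊢
      exact hf.row a j j' h1 h2 h
  · have h3 := hle (a, j)
    by_cases e : (a, j) = (i, lam i) <;> by_cases e' : (a', j) = (i, lam i)
    · simp only [Prod.mk.injEq] at e e'
      rw [e.1, e'.1] at h
      exact absurd h (lt_irrefl _)
    · rw [Function.update_of_ne e'] at h2
      simp only [Prod.mk.injEq] at e
      obtain ⟨rfl, rfl⟩ := e
      have h4 := (hcell _ h2).2
      have h5 := hlam a' h
      simp only at h4
      omega
    · rw [Function.update_of_ne e, e', Function.update_self]
      omega
    · rw [Function.update_of_ne e] at h1 ⊢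
      rw [Function.update_of_ne e'] at h2 ⊢
      exact hf.col a a' j h1 h2 h

-- Removing the last entry M + 1 can only affect the descent at M, which depends on whether M lies
-- above row `i`.
open Classical in
lemma majFun_removeLast (hf : IsSYT lam mu f) {M : ℕ} (hM : skewSize lam mu = M + 1)
    (hi : f (i, lam i) = M + 1) :
    majFun (M + 1) f = majFun M (Function.update f (i, lam i) 0) +
      if ∃ c, Function.update f (i, lam i) 0 c = M ∧ c.1 < i then M else 0 := by
  have hle : ∀ c, f c ≤ M + 1 := hM ▸ hf.le_size
  have hlast : ∀ c, f c = M + 1 → c = (i, lam i) := fun c hc =>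
    hf.inj c _ (by omega) (by rw [hc, hi])
  have hup : ∀ k, k ≠ 0 → k ≠ M + 1 → ∀ c, Function.update f (i, lam i) 0 c = k ↔ f c = k := by
    intro k hk0 hkM c
    by_cases h : c = (i, lam i)
    · rw [h, Function.update_self]
      omega
    · rw [Function.update_of_ne h]
  simp only [majFun, sum_filter]
  rw [sum_Icc_succ_top (by omega), if_neg (t := M + 1), add_zero]
  swap
  · rintro ⟨c, d, -, h, -⟩
    have := hle d
    omega
  -- For M = 0 the test is met by cells off the diagram, where the function is 0, but the
  -- contribution is 0 either way.
  rcases M with _ | M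
  · simp
  rw [sum_Icc_succ_top (by omega), sum_Icc_succ_top (by omega)]
  -- The top index is no descent of the shortened tableau, since its successor has been removed.
  rw [if_neg (t := M + 1) (c := ∃ c d, Function.update f (i, lam i) 0 c = M + 1 ∧ _), add_zero]
  swap
  · rintro ⟨c, d, -, h, -⟩
    by_cases h' : d = (i, lam i)
    · rw [h', Function.update_self] at h
      omega
    · rw [Function.update_of_ne h'] at h
      exact h' (hlast d h)
  congr 1
  · refine sum_congr rfl fun k hk => ?_
    have := mem_Icc.1 hk
    simp only [hup k (by omega) (by omega), hup (k + 1) (by omega) (by omega)]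
  · have : (∃ c d, f c = M + 1 ∧ f d = M + 1 + 1 ∧ c.1 < d.1) ↔
        ∃ c, Function.update f (i, lam i) 0 c = M + 1 ∧ c.1 < i := by
      simp only [hup (M + 1) (by omega) (by omega)]
      constructor
      · rintro ⟨c, d, hc, hd, h⟩
        rw [hlast d hd] at h
        exact ⟨c, hc, h⟩
      · rintro ⟨c, hc, h⟩
        exact ⟨c, _, hc, hi, h⟩
    simp only [this]

end IsSYT

/-! ### The refined generating function and its determinant formula. -/

open Classical in
/-- The generating function of tableaux for the major index, computed as if another entry were
added in row `t`. -/
noncomputable def majSum {K : Type*} [Field K] (q : K) {n : ℕ} (t : ℕ) (lam mu : Fin n → ℕ) : K :=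
  ∑ f ∈ sytFinset lam mu, q ^ majFun (skewSize lam mu) f *
    if ∃ c : Fin n × ℕ, f c = skewSize lam mu ∧ (c.1 : ℕ) < t then q ^ skewSize lam mu else 1

lemma majSum_zero {K : Type*} [Field K] (q : K) {n : ℕ} (lam mu : Fin n → ℕ) :
    majSum q 0 lam mu = ∑ T : SkewSYT lam mu, q ^ T.maj := by
  rw [sum_skewSYT]
  exact sum_congr rfl fun f _ => by simp

lemma majSum_of_skewSize_eq_zero {K : Type*} [Field K] (q : K) {n : ℕ} (t : ℕ)
    (lam mu : Fin n → ℕ) (h : skewSize lam mu = 0) : majSum q t lam mu = 1 := by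
  have hc : ∀ c, c ∉ skewCells lam mu := by
    intro c hc
    have h1 := mem_skewCells.1 hc
    have h2 := (sum_eq_zero_iff.1 h) c.1 (mem_univ _)
    omega
  have hs : sytFinset lam mu = {fun _ => 0} := by
    ext f
    rw [mem_sytFinset, mem_singleton]
    constructor
    · intro hf
      funext c
      by_contra h0
      exact hc c ((hf.ne_zero_iff c).1 h0)
    · rintro rfl
      exact ⟨fun c => by simp [hc], by simp, by simp, fun k h1 h2 => by omega, by simp, by simp⟩
  rw [majSum, hs, sum_singleton, h]
  simp [majFun]

-- With the largest entry in row `i`, the remaining tableau is counted with threshold `i`: this is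
-- what forces the refinement by `t`.
open Classical in
lemma sum_filter_last {K : Type*} [Field K] (q : K) {n : ℕ} {lam mu : Fin n → ℕ} (i : Fin n)
    (hlt : mu i < lam i) (hlam : ∀ i', i < i' → lam i' < lam i) :
    ∑ f ∈ (sytFinset lam mu).filter (fun f => f (i, lam i) = skewSize lam mu),
      q ^ majFun (skewSize lam mu) f = majSum q i (Function.update lam i (lam i - 1)) mu := by
  have hsize := skewSize_update hlt
  refine sum_bij' (fun f _ => Function.update f (i, lam i) 0)
    (fun f _ => Function.update f (i, lam i) (skewSize lam mu)) ?_ ?_ ?_ ?_ ?_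
  · intro f hf
    rw [mem_filter, mem_sytFinset] at hf
    exact mem_sytFinset.2 (hf.1.removeLast (by omega) hf.2)
  · intro f hf
    rw [mem_sytFinset] at hf
    exact mem_filter.2 ⟨mem_sytFinset.2 (hf.addLast hlt hlam), Function.update_self ..⟩
  · intro f hf
    simp [← (mem_filter.1 hf).2]
  · intro f hf
    rw [mem_sytFinset] at hf
    have : f (i, lam i) = 0 := by
      by_contra h
      exact ((mem_skewCells_update hlt _).1 ((hf.ne_zero_iff _).1 h)).2 rfl
    simp [← this]
  · intro f hf
    rw [mem_filter, mem_sytFinset] at hf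
    rw [hsize, hf.1.majFun_removeLast (i := i) hsize (by omega), pow_add]
    simp only [← Fin.lt_def]
    congr 1
    split_ifs <;> simp

open Classical in
lemma majSum_eq_sum {K : Type*} [Field K] (q : K) {n : ℕ} {lam mu : Fin n → ℕ}
    (hN : skewSize lam mu ≠ 0) (t : ℕ) :
    majSum q t lam mu = ∑ i : Fin n,
      (∑ f ∈ (sytFinset lam mu).filter (fun f => f (i, lam i) = skewSize lam mu),
        q ^ majFun (skewSize lam mu) f) * if (i : ℕ) < t then q ^ skewSize lam mu else 1 := by
  simp only [sum_mul, sum_filter]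
  rw [majSum, sum_comm]
  refine sum_congr rfl fun f hf => ?_
  rw [mem_sytFinset] at hf
  obtain ⟨i, hi⟩ := hf.exists_last hN
  rw [sum_eq_single i, if_pos hi]
  · have : (∃ c : Fin n × ℕ, f c = skewSize lam mu ∧ (c.1 : ℕ) < t) ↔ (i : ℕ) < t := by
      constructor
      · rintro ⟨c, hc, h⟩
        rw [hf.inj c (i, lam i) (by omega) (by omega)] at h
        exact h
      · exact fun h => ⟨_, hi, h⟩
    simp only [this]
  · intro b _ hb
    rw [if_neg, zero_mul]
    intro h
    exact hb (congrArg Prod.fst (hf.inj (b, lam b) (i, lam i) (by omega) (by omega)))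
  · simp

/-- The generating function for the major index as a determinant. -/
theorem majSum_eq_det {K : Type*} [Field K] {q : K} (hq0 : q ≠ 0)
    (hq : ∀ k : ℕ, 1 - q ^ (k + 1) ≠ 0) {n : ℕ} {mu : Fin n → ℕ} (hmu : Antitone mu) (N : ℕ) :
    ∀ lam : Fin n → ℕ, Antitone lam → mu ≤ lam → skewSize lam mu = N → ∀ t ≤ n,
      majSum q t lam mu =
        poch q N * (jacobiTrudi q t (fun i => (lam i : ℤ)) (fun i => (mu i : ℤ))).det := by
  classical
  have hmu' : Antitone fun i => (mu i : ℤ) := fun a b h => Int.ofNat_le.2 (hmu h)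
  induction N with
  | zero =>
    intro lam _ hle hN t _
    have : lam = mu := by
      funext i
      have h1 := (sum_eq_zero_iff.1 hN) i (mem_univ _)
      have h2 : mu i ≤ lam i := hle i
      have h3 : lam i - mu i = 0 := h1
      omega
    rw [majSum_of_skewSize_eq_zero q t lam mu hN, this, det_jacobiTrudi_self q t _ hmu', poch_zero,
      one_mul]
  | succ N ih =>
    intro lam hlam hle hN t ht
    have hlam' : Antitone fun i => (lam i : ℤ) := fun a b h => Int.ofNat_le.2 (hlam h)
    set d : Fin n → K := fun i => (jacobiTrudi q i
      (Function.update (fun i => (lam i : ℤ)) i ((lam i : ℤ) - 1)) (fun i => (mu i : ℤ))).det with hd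
    -- If row `i` ends in a removable corner this is the induction hypothesis at threshold `i`;
    -- otherwise no tableau has its largest entry there, and the determinant vanishes too.
    have hF : ∀ i, ∑ f ∈ (sytFinset lam mu).filter (fun f => f (i, lam i) = skewSize lam mu),
        q ^ majFun (skewSize lam mu) f = poch q N * d i := by
      intro i
      by_cases hlt : mu i < lam i
      · by_cases hdesc : ∀ i', i < i' → lam i' < lam i
        · have hsize := skewSize_update hlt
          have hcast : (fun j => ((Function.update lam i (lam i - 1) j : ℕ) : ℤ)) =
              Function.update (fun i => (lam i : ℤ)) i ((lam i : ℤ) - 1) := by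
            funext j
            by_cases h : j = i
            · subst h
              simp only [Function.update_self]
              omega
            · simp [h]
          rw [sum_filter_last q i hlt hdesc, ih _ ?_ ?_ ?_ _ i.2.le, hcast]
          · intro a b hab
            have h1 := hlam hab
            by_cases ha : a = i <;> by_cases hb : b = i
            · rw [ha, hb]
            · have := hdesc b (lt_of_le_of_ne (ha ▸ hab) (Ne.symm hb))
              rw [ha, Function.update_self, Function.update_of_ne hb]
              omega
            · rw [hb, Function.update_self, Function.update_of_ne ha]
              rw [hb] at h1
              omega
            · rwa [Function.update_of_ne ha, Function.update_of_ne hb]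
          · intro a
            by_cases ha : a = i
            · rw [ha, Function.update_self]
              exact Nat.le_sub_one_of_lt hlt
            · rw [Function.update_of_ne ha]
              exact hle a
          · exact Nat.succ_injective (hsize.symm.trans hN)
        · have hz : d i = 0 := by
            push Not at hdesc
            obtain ⟨i', h1, h2⟩ := hdesc
            have h1' : (i : ℕ) < i' := h1
            have hi'n := i'.2
            have h3 : lam i' ≤ lam ⟨i + 1, by omega⟩ := hlam (Fin.le_def.2 (by simp; omega))
            have h4 : lam ⟨i + 1, by omega⟩ ≤ lam i := hlam (Fin.le_def.2 (by simp))
            exact det_jacobiTrudi_eq_zero_of_eq q i ⟨i + 1, by omega⟩ rfl _ _ (by simp; omega)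
          rw [hz, mul_zero]
          refine sum_eq_zero fun f hf => absurd ?_ hdesc
          rw [mem_filter, mem_sytFinset] at hf
          exact fun i' h => hf.1.antitone_of_last hmu (by omega) hf.2 h
      · have : mu i ≤ lam i := hle i
        have hz : d i = 0 := det_jacobiTrudi_eq_zero_of_le q i i _ _ hlam' hmu' (by simp; omega)
        rw [hz, mul_zero]
        refine sum_eq_zero fun f hf => absurd ?_ hlt
        rw [mem_filter, mem_sytFinset] at hf
        exact hf.1.lt_of_last (by omega) hf.2
    have hsum : (∑ i, ((lam i : ℤ) - mu i)) = ((N + 1 : ℕ) : ℤ) := by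
      rw [← hN, skewSize]
      push_cast
      exact sum_congr rfl fun i _ => (Nat.cast_sub (hle i)).symm
    -- Comparing the two evaluations at threshold `n` gives `(1 - q ^ (N + 1)) * det = ∑ i, d i`,
    -- with `det` taken at threshold 0.
    have h1 := det_jacobiTrudi_last hq0 (fun i => (lam i : ℤ)) (fun i => (mu i : ℤ))
    rw [hsum, zpow_natCast, det_jacobiTrudi_eq_sub_sum hq n le_rfl] at h1
    simp only [Fin.is_lt, if_true] at h1
    rw [majSum_eq_sum q (by omega), det_jacobiTrudi_eq_sub_sum hq t ht, hN, poch_succ]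
    simp only [← hN, hF]
    simp only [hN]
    have h2 : ∀ i : Fin n, poch q N * d i * (if (i : ℕ) < t then q ^ (N + 1) else 1) =
        poch q N * d i - poch q N * (1 - q ^ (N + 1)) * if (i : ℕ) < t then d i else 0 := by
      intro i
      split_ifs <;> ring
    rw [sum_congr rfl fun i _ => h2 i, sum_sub_distrib, ← mul_sum, ← mul_sum]
    linear_combination (-poch q N) * h1

/-! ### Krattenthaler's determinant. -/

lemma prod_fin_Ioi_eq_prod_range {K : Type*} [CommMonoid K] (r : ℕ) (F : ℕ → ℕ → K) :
    ∏ i : Fin r, ∏ j ∈ Ioi i, F i j = ∏ j ∈ range r, ∏ i ∈ range j, F i j := by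
  have h1 : ∀ i : Fin r, ∏ j ∈ Ioi i, F i j =
      ∏ j ∈ range r, if (i : ℕ) < j then F i j else 1 := by
    intro i
    rw [← Fin.prod_univ_eq_prod_range (fun j => if (i : ℕ) < j then F i j else 1), ← prod_filter]
    congr 1
    ext j
    simp
  rw [prod_congr rfl fun i _ => h1 i,
    Fin.prod_univ_eq_prod_range (fun i => ∏ j ∈ range r, if i < j then F i j else 1), prod_comm]
  refine prod_congr rfl fun j hj => ?_
  rw [← prod_filter]
  congr 1
  ext i
  have := mem_range.1 hj
  simp
  omega

lemma det_vandermonde_range {K : Type*} [CommRing K] (r : ℕ) (X : ℕ → K) :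
    (Matrix.vandermonde fun i : Fin r => X i).det =
      ∏ j ∈ range r, ∏ i ∈ range j, (X j - X i) := by
  rw [Matrix.det_vandermonde, ← prod_fin_Ioi_eq_prod_range r fun i j => X j - X i]

/-- Krattenthaler's determinant lemma. -/
lemma det_prod_sub_mul_prod_sub {K : Type*} [Field K] (r : ℕ) (X a b : ℕ → K)
    (ha : Function.Injective a) :
    (Matrix.of fun i j : Fin r => (∏ t ∈ range j, (X i - a t)) *
      ∏ t ∈ Ico ((j : ℕ) + 1) r, (X i - b t)).det =
      ∏ j ∈ range r, ∏ i ∈ range j, ((X j - X i) * (a i - b j)) := by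
  set P : Fin r → Polynomial K := fun j =>
    (∏ t ∈ range j, (Polynomial.X - Polynomial.C (a t))) *
      ∏ t ∈ Ico ((j : ℕ) + 1) r, (Polynomial.X - Polynomial.C (b t)) with hP
  have hdeg : ∀ j, (P j).natDegree < r := by
    intro j
    have := j.2
    rw [hP, Polynomial.Monic.natDegree_mul (Polynomial.monic_prod_X_sub_C _ _)
      (Polynomial.monic_prod_X_sub_C _ _), Polynomial.natDegree_prod_of_monic _ _
      fun t _ => Polynomial.monic_X_sub_C _, Polynomial.natDegree_prod_of_monic _ _
      fun t _ => Polynomial.monic_X_sub_C _]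
    simp
    omega
  -- Column `j` evaluates a polynomial of degree below `r`, so the determinant is a Vandermonde
  -- times a constant independent of the points `Y`.
  have hfac : ∀ Y : ℕ → K, (Matrix.of fun i j : Fin r => (∏ t ∈ range j, (Y i - a t)) *
      ∏ t ∈ Ico ((j : ℕ) + 1) r, (Y i - b t)) = (Matrix.vandermonde fun i : Fin r => Y i) *
        Matrix.of fun k j : Fin r => (P j).coeff k := by
    intro Y
    ext i j
    have h1 : (P j).eval (Y i) = (∏ t ∈ range j, (Y i - a t)) *
        ∏ t ∈ Ico ((j : ℕ) + 1) r, (Y i - b t) := by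
      simp [hP, Polynomial.eval_prod]
    rw [Matrix.of_apply, ← h1, Polynomial.eval_eq_sum_range' (hdeg j), Matrix.mul_apply,
      ← Fin.sum_univ_eq_sum_range (fun k => (P j).coeff k * Y i ^ k)]
    exact sum_congr rfl fun k _ => by rw [Matrix.vandermonde_apply, Matrix.of_apply, mul_comm]
  -- The constant is found at `Y = a`, where the matrix is triangular; distinctness of the `a i`
  -- allows division by their Vandermonde.
  have hA : (Matrix.of fun i j : Fin r => (∏ t ∈ range j, (a i - a t)) *
      ∏ t ∈ Ico ((j : ℕ) + 1) r, (a i - b t)).det =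
      (∏ j ∈ range r, ∏ i ∈ range j, (a j - a i)) * ∏ j ∈ range r, ∏ i ∈ range j, (a i - b j) := by
    rw [Matrix.det_of_isLowerTriangular]
    · rw [← prod_fin_Ioi_eq_prod_range r fun i j => a i - b j,
        ← Fin.prod_univ_eq_prod_range (fun j => ∏ i ∈ range j, (a j - a i)), ← prod_mul_distrib]
      refine prod_congr rfl fun i _ => ?_
      rw [Matrix.of_apply]
      congr 1
      refine (prod_bij (fun (j : Fin r) _ => (j : ℕ)) ?_ ?_ ?_ ?_).symm
      · intro j hj
        have h1 : i < j := mem_Ioi.1 hj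
        have h2 : (i : ℕ) < j := h1
        have := j.2
        simp
        omega
      · exact fun _ _ _ _ h => Fin.ext h
      · intro t ht
        rw [mem_Ico] at ht
        exact ⟨⟨t, ht.2⟩, mem_Ioi.2 (Fin.lt_def.2 ht.1), rfl⟩
      · exact fun _ _ => rfl
    · intro i j hij
      rw [Matrix.of_apply, prod_eq_zero (mem_range.2 (show (i : ℕ) < j from hij)) (sub_self _),
        zero_mul]
  have hV : ∏ j ∈ range r, ∏ i ∈ range j, (a j - a i) ≠ 0 := by
    refine prod_ne_zero_iff.2 fun j _ => prod_ne_zero_iff.2 fun i hi => ?_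
    rw [sub_ne_zero]
    exact fun h => (mem_range.1 hi).ne' (ha h)
  rw [hfac, Matrix.det_mul, det_vandermonde_range] at hA
  rw [hfac, Matrix.det_mul, det_vandermonde_range, mul_left_cancel₀ hV hA]
  simp only [prod_mul_distrib]

/-! ### Newton expansion at the odd powers of `q`. -/

/-- The coefficients of `∏ t < c, (1 - x / q ^ t)` in the Newton basis
`∏ j < k, (x - q ^ (2 * j + 1))`. -/
def newtonCoeff {K : Type*} [Field K] (q : K) (k : ℤ) (c : ℕ) : K :=
  (-1) ^ k * q ^ ((c.choose 2 : ℤ) + k ^ 2 + k - 2 * c * k) * poch q (c + 1) *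
    invPoch (q ^ 2) (c - k) * invPoch q (2 * k + 1 - c)

lemma newtonCoeff_of_lt {K : Type*} [Field K] (q : K) {k : ℤ} {c : ℕ} (h : (c : ℤ) < k) :
    newtonCoeff q k c = 0 := by
  rw [newtonCoeff, invPoch_of_neg (q ^ 2) (by omega)]
  ring

lemma newtonCoeff_of_neg {K : Type*} [Field K] (q : K) {k : ℤ} (c : ℕ) (h : k < 0) :
    newtonCoeff q k c = 0 := by
  rw [newtonCoeff, invPoch_of_neg q (by omega)]
  ring

lemma one_sub_sq_pow_ne_zero {K : Type*} [Field K] {q : K} (hq : ∀ k : ℕ, 1 - q ^ (k + 1) ≠ 0)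
    (k : ℕ) : 1 - (q ^ 2) ^ (k + 1) ≠ 0 := by
  rw [← pow_mul]
  exact hq (2 * k + 1)

/-- This is the recurrence forced by writing the new factor `1 - x * q ^ (-c)` as `(1 - q ^ (2 * k +
1 - c)) - q ^ (-c) * (x - q ^ (2 * k + 1))`. -/
lemma newtonCoeff_succ {K : Type*} [Field K] {q : K} (hq0 : q ≠ 0)
    (hq : ∀ k : ℕ, 1 - q ^ (k + 1) ≠ 0) (k : ℤ) (c : ℕ) :
    newtonCoeff q k (c + 1) = (1 - q ^ (2 * k + 1 - c)) * newtonCoeff q k c -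
      q ^ (-(c : ℤ)) * newtonCoeff q (k - 1) c := by
  obtain ⟨d, hd⟩ : ∃ d : ℤ, (c : ℤ) = k + d := ⟨c - k, by ring⟩
  have e1 : invPoch q (2 * k + 1 - (c + 1 : ℕ)) =
      (1 - q ^ (2 * k + 1 - c)) * invPoch q (2 * k + 1 - c) := by
    rw [← invPoch_sub_one hq]
    congr 1
    push_cast
    ring
  have e2 : invPoch q (2 * (k - 1) + 1 - c) = (1 - q ^ (2 * k - c)) *
      ((1 - q ^ (2 * k + 1 - c)) * invPoch q (2 * k + 1 - c)) := by
    rw [← e1, show 2 * k + 1 - ((c + 1 : ℕ) : ℤ) = 2 * k - c by push_cast; ring,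
      ← invPoch_sub_one hq]
    congr 1
    ring
  have e3 : invPoch (q ^ 2) (c - k) =
      (1 - (q ^ 2) ^ (c + 1 - k)) * invPoch (q ^ 2) (c + 1 - k) := by
    rw [← invPoch_sub_one (one_sub_sq_pow_ne_zero hq)]
    congr 1
    ring
  have e4 : (((c + 1).choose 2 : ℕ) : ℤ) = c.choose 2 + c := by
    rw [Nat.choose_succ_succ' c 1, Nat.choose_one_right]
    push_cast
    ring
  unfold newtonCoeff
  rw [e1, e2, e3, e4, poch_succ q (c + 1), show ((c + 1 : ℕ) : ℤ) - k = c + 1 - k by push_cast; ring,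
    show (c : ℤ) - (k - 1) = c + 1 - k by ring]
  set u := invPoch q (2 * k + 1 - c)
  set v := invPoch (q ^ 2) (c + 1 - k)
  set E : ℤ := (c.choose 2 : ℤ) + k ^ 2 + k - 2 * c * k with hE
  have f1 : q ^ ((c.choose 2 : ℤ) + c + k ^ 2 + k - 2 * ((c + 1 : ℕ) : ℤ) * k) =
      q ^ E * (q ^ d / q ^ k) := by
    rw [← zpow_sub₀ hq0, ← zpow_add₀ hq0]
    congr 1
    rw [hE, hd]
    push_cast
    rw [hd]
    ring
  have f2 : q ^ (-(c : ℤ)) * q ^ ((c.choose 2 : ℤ) + (k - 1) ^ 2 + (k - 1) - 2 * c * (k - 1)) =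
      q ^ E * (q ^ d / q ^ k) := by
    rw [← zpow_sub₀ hq0, ← zpow_add₀ hq0, ← zpow_add₀ hq0]
    congr 1
    rw [hE, hd]
    ring
  have f3 : (q ^ 2) ^ ((c : ℤ) + 1 - k) = (q ^ d) ^ 2 * q ^ 2 := by
    rw [← zpow_natCast q 2, ← zpow_natCast (q ^ d) 2, ← zpow_mul, ← zpow_mul,
      ← zpow_add₀ hq0, hd]
    congr 1
    push_cast
    ring
  have f4 : q ^ (2 * k - (c : ℤ)) = q ^ k / q ^ d := by
    rw [← zpow_sub₀ hq0, hd]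
    congr 1
    ring
  have f5 : q ^ (c + 1 + 1) = q ^ k * q ^ d * q ^ 2 := by
    rw [← zpow_add₀ hq0, ← hd, zpow_natCast]
    ring
  have f6 : (-1 : K) ^ (k - 1) = -(-1) ^ k := by
    rw [zpow_sub₀ (by simp), zpow_one, div_neg, div_one]
  rw [f1, f3, f4, f5, f6]
  have hx : q ^ k ≠ 0 := zpow_ne_zero _ hq0
  have hy : q ^ d ≠ 0 := zpow_ne_zero _ hq0
  -- With `c = k + d`, the recurrence comes down to this identity in `q ^ k` and `q ^ d`.
  have h7 : q ^ d / q ^ k * (1 - q ^ k * q ^ d * q ^ 2) =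
      (1 - (q ^ d) ^ 2 * q ^ 2) + q ^ d / q ^ k * (1 - q ^ k / q ^ d) := by
    field_simp
    ring
  linear_combination ((-1) ^ k * q ^ E * poch q (c + 1) * v * (1 - q ^ (2 * k + 1 - (c : ℤ))) * u) * h7
    - ((-1) ^ k * poch q (c + 1) * v * (1 - q ^ k / q ^ d) * (1 - q ^ (2 * k + 1 - (c : ℤ))) * u) * f2

lemma prod_one_sub_eq_sum_newtonCoeff {K : Type*} [Field K] {q : K} (hq0 : q ≠ 0)
    (hq : ∀ k : ℕ, 1 - q ^ (k + 1) ≠ 0) (x : K) (c : ℕ) :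
    ∏ t ∈ range c, (1 - x * q ^ (-(t : ℤ))) =
      ∑ k ∈ range (c + 1), newtonCoeff q k c * ∏ j ∈ range k, (x - q ^ (2 * j + 1)) := by
  induction c with
  | zero =>
    have : 1 - q ≠ 0 := by simpa using hq 0
    simp [newtonCoeff, invPoch, poch, this]
  | succ c ih =>
    rw [prod_range_succ, ih]
    have h1 : ∀ k : ℕ, newtonCoeff q k (c + 1) * ∏ j ∈ range k, (x - q ^ (2 * j + 1)) =
        (1 - q ^ (2 * (k : ℤ) + 1 - c)) * newtonCoeff q k c * ∏ j ∈ range k, (x - q ^ (2 * j + 1)) -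
        q ^ (-(c : ℤ)) * newtonCoeff q ((k : ℤ) - 1) c * ∏ j ∈ range k, (x - q ^ (2 * j + 1)) := by
      intro k
      rw [newtonCoeff_succ hq0 hq]
      ring
    rw [sum_congr rfl fun k _ => h1 k, sum_sub_distrib, sum_range_succ _ (c + 1),
      sum_range_succ' _ (c + 1), newtonCoeff_of_lt q (k := ((c + 1 : ℕ) : ℤ)) (by push_cast; omega),
      newtonCoeff_of_neg q (k := ((0 : ℕ) : ℤ) - 1) c (by simp), sum_mul]
    simp only [mul_zero, zero_mul, add_zero]
    rw [← sum_sub_distrib]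
    refine sum_congr rfl fun k _ => ?_
    have h2 : q ^ (2 * (k : ℤ) + 1 - c) = q ^ (2 * k + 1) * q ^ (-(c : ℤ)) := by
      rw [← zpow_natCast q (2 * k + 1), ← zpow_add₀ hq0]
      congr 1
    rw [prod_range_succ, h2]
    push_cast
    rw [add_sub_cancel_right]
    ring

/-! ### Factoring the staircase determinant. -/

lemma invPoch_sub_natCast {K : Type*} [Field K] {q : K} (hq : ∀ k : ℕ, 1 - q ^ (k + 1) ≠ 0)
    (a : ℤ) (c : ℕ) :
    invPoch q (a - c) = invPoch q a * ∏ t ∈ range c, (1 - q ^ (a - t)) := by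
  induction c with
  | zero => simp
  | succ c ih =>
    rw [prod_range_succ, ← mul_assoc, ← ih, mul_comm, ← invPoch_sub_one hq]
    congr 1
    push_cast
    ring

lemma invPoch_add_eq_mul_prod_Ico {K : Type*} [Field K] {q : K}
    (hq : ∀ k : ℕ, 1 - q ^ (k + 1) ≠ 0) (a : ℤ) {v r : ℕ} (h : v + 1 ≤ r) :
    invPoch q (a + v) = invPoch q (a + r - 1) * ∏ t ∈ Ico (v + 1) r, (1 - q ^ (a + t)) := by
  induction r, h using Nat.le_induction with
  | base => simp [add_sub_assoc]
  | succ r h ih =>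
    rw [prod_Ico_succ_top (by omega), ih, invPoch_sub_one hq,
      show a + ((r + 1 : ℕ) : ℤ) - 1 = a + r by push_cast; ring]
    ring

/-- The Newton basis polynomial of index `k` vanishes at `q ^ (2 * i + 1)` for `k > i`, so
evaluating the basis at these points gives a lower triangular matrix. -/
lemma det_invPoch_eq_mul_det_newtonCoeff {K : Type*} [Field K] {q : K} (hq0 : q ≠ 0)
    (hq : ∀ k : ℕ, 1 - q ^ (k + 1) ≠ 0) (n : ℕ) (c : Fin n → ℕ) :
    (Matrix.of fun i j : Fin n => invPoch q (2 * (i : ℤ) + 1 - c j)).det =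
      (∏ i ∈ range n, (poch q (2 * i + 1))⁻¹) *
      (∏ i ∈ range n, ∏ j ∈ range i, (q ^ (2 * i + 1) - q ^ (2 * j + 1))) *
      (Matrix.of fun k j : Fin n => newtonCoeff q (k : ℕ) (c j)).det := by
  have hfac : (Matrix.of fun i j : Fin n => invPoch q (2 * (i : ℤ) + 1 - c j)) =
      Matrix.of fun i j : Fin n => (poch q (2 * (i : ℕ) + 1))⁻¹ *
        ((Matrix.of fun i k : Fin n => ∏ j ∈ range (k : ℕ), (q ^ (2 * (i : ℕ) + 1) - q ^ (2 * j + 1))) *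
          Matrix.of fun k j : Fin n => newtonCoeff q (k : ℕ) (c j)) i j := by
    ext i j
    rw [Matrix.of_apply, Matrix.of_apply, invPoch_sub_natCast hq,
      show (2 * (i : ℤ) + 1) = ((2 * (i : ℕ) + 1 : ℕ) : ℤ) by push_cast; ring, invPoch_natCast,
      Matrix.mul_apply]
    have h1 : ∀ t : ℕ, q ^ (((2 * (i : ℕ) + 1 : ℕ) : ℤ) - t) =
        q ^ (2 * (i : ℕ) + 1) * q ^ (-(t : ℤ)) := by
      intro t
      rw [← zpow_natCast q (2 * (i : ℕ) + 1), ← zpow_add₀ hq0, sub_eq_add_neg]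
    rw [prod_congr rfl fun t _ => congrArg (fun z => 1 - z) (h1 t),
      prod_one_sub_eq_sum_newtonCoeff hq0 hq]
    congr 1
    set G : ℕ → K := fun k => newtonCoeff q k (c j) *
      ∏ j ∈ range k, (q ^ (2 * (i : ℕ) + 1) - q ^ (2 * j + 1)) with hG
    -- Terms with `k > c j` have zero coefficient; terms with `k ≥ n > i` have a zero basis
    -- polynomial.
    have h2 : ∑ k ∈ range (c j + 1), G k = ∑ k ∈ range n, G k := by
      rw [sum_subset (range_mono (le_max_left (c j + 1) n)) (f := G),
        sum_subset (range_mono (le_max_right (c j + 1) n)) (f := G)]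
      · intro k _ hk
        have hk' : (i : ℕ) < k := i.2.trans_le (by simpa using hk)
        simp only [hG]
        rw [prod_eq_zero (mem_range.2 hk') (sub_self _), mul_zero]
      · intro k _ hk
        have hk' : c j < k := by simpa using hk
        simp only [hG]
        rw [newtonCoeff_of_lt q (by omega), zero_mul]
    rw [h2, ← Fin.sum_univ_eq_sum_range]
    exact sum_congr rfl fun k _ => by rw [Matrix.of_apply, Matrix.of_apply, mul_comm]
  have hlow : (Matrix.of fun i k : Fin n =>
      ∏ j ∈ range (k : ℕ), (q ^ (2 * (i : ℕ) + 1) - q ^ (2 * j + 1))).det =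
      ∏ i ∈ range n, ∏ j ∈ range i, (q ^ (2 * i + 1) - q ^ (2 * j + 1)) := by
    rw [Matrix.det_of_isLowerTriangular]
    · exact Fin.prod_univ_eq_prod_range
        (fun i => ∏ j ∈ range i, (q ^ (2 * i + 1) - q ^ (2 * j + 1))) n
    · intro i k hik
      exact prod_eq_zero (mem_range.2 (show (i : ℕ) < k from hik)) (sub_self _)
  rw [hfac, Matrix.det_mul_column, Matrix.det_mul, hlow,
    Fin.prod_univ_eq_prod_range (fun i => (poch q (2 * i + 1))⁻¹), mul_assoc]

lemma newtonCoeff_self {K : Type*} [Field K] {q : K} (hq : ∀ k : ℕ, 1 - q ^ (k + 1) ≠ 0) (k : ℕ) :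
    newtonCoeff q k k = (-1) ^ k * q ^ ((k.choose 2 : ℤ) + k - k ^ 2) := by
  have h := poch_ne_zero hq (k + 1)
  rw [newtonCoeff, sub_self, show 2 * (k : ℤ) + 1 - k = ((k + 1 : ℕ) : ℤ) by push_cast; ring,
    invPoch_natCast, zpow_natCast]
  have : invPoch (q ^ 2) 0 = 1 := by simp [invPoch, poch]
  rw [this, show (k.choose 2 : ℤ) + k ^ 2 + k - 2 * k * k = k.choose 2 + k - k ^ 2 by ring]
  field_simp

/-- Row factor, column factor, and the shape of Krattenthaler's lemma with `X u = q ^ (2 * (s +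
u))`, `a t = q ^ (s + m + t - 1)`, `b t = q ^ (2 * (s + m + t))`. The products arise by moving each
`invPoch` to an argument free of `v`. -/
lemma newtonCoeff_eq_mul {K : Type*} [Field K] {q : K} (hq0 : q ≠ 0)
    (hq : ∀ k : ℕ, 1 - q ^ (k + 1) ≠ 0) (s m r u v : ℕ) (hv : v < r) :
    newtonCoeff q ((s + u : ℕ) : ℤ) (s + m + v) =
      ((-1) ^ (s + u) * q ^ (((s : ℤ) + u) ^ 2 + (s + u) - 2 * (s + u) * (s + m + r - 1)) *
        invPoch (q ^ 2) ((m : ℤ) - u + r - 1) * invPoch q ((s : ℤ) + 1 - m + 2 * u)) *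
      ((q ^ ((s + m + v).choose 2) * poch q (s + m + v + 1) *
        ∏ t ∈ range v, -q ^ (1 - (s : ℤ) - m - t)) *
      ((∏ t ∈ range v, (q ^ (2 * (s + u)) - q ^ ((s : ℤ) + m + t - 1))) *
        ∏ t ∈ Ico (v + 1) r, (q ^ (2 * (s + u)) - q ^ (2 * (s + m + t))))) := by
  have hx : q ^ (2 * (s + u)) ≠ 0 := pow_ne_zero _ hq0
  have e1 : invPoch (q ^ 2) (((s + m + v : ℕ) : ℤ) - ((s + u : ℕ) : ℤ)) =
      invPoch (q ^ 2) ((m : ℤ) - u + r - 1) * (q ^ (-(2 * ((s : ℤ) + u)) * (r - 1 - v)) *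
        ∏ t ∈ Ico (v + 1) r, (q ^ (2 * (s + u)) - q ^ (2 * (s + m + t)))) := by
    rw [show ((s + m + v : ℕ) : ℤ) - ((s + u : ℕ) : ℤ) = (m : ℤ) - u + v by push_cast; ring,
      invPoch_add_eq_mul_prod_Ico (one_sub_sq_pow_ne_zero hq) _ (show v + 1 ≤ r from hv)]
    congr 1
    have h1 : ∀ t ∈ Ico (v + 1) r, 1 - (q ^ 2) ^ ((m : ℤ) - u + t) =
        q ^ (-(2 * ((s : ℤ) + u))) * (q ^ (2 * (s + u)) - q ^ (2 * (s + m + t))) := by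
      intro t _
      rw [← zpow_natCast q 2, ← zpow_natCast, ← zpow_natCast, mul_sub, ← zpow_add₀ hq0,
        ← zpow_add₀ hq0, ← zpow_mul]
      congr 1
      · rw [← zpow_zero q]
        congr 1
        push_cast
        ring
      · congr 1
        push_cast
        ring
    rw [prod_congr rfl h1, prod_mul_distrib, prod_const, Nat.card_Ico, zpow_mul, ← zpow_natCast]
    congr 3
    omega
  have e2 : invPoch q (2 * ((s + u : ℕ) : ℤ) + 1 - ((s + m + v : ℕ) : ℤ)) =
      invPoch q ((s : ℤ) + 1 - m + 2 * u) * ((∏ t ∈ range v, -q ^ (1 - (s : ℤ) - m - t)) *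
        ∏ t ∈ range v, (q ^ (2 * (s + u)) - q ^ ((s : ℤ) + m + t - 1))) := by
    rw [show 2 * ((s + u : ℕ) : ℤ) + 1 - ((s + m + v : ℕ) : ℤ) = (s : ℤ) + 1 - m + 2 * u - v by
      push_cast; ring, invPoch_sub_natCast hq, ← prod_mul_distrib]
    congr 1
    refine prod_congr rfl fun t _ => ?_
    rw [← zpow_natCast, mul_sub, neg_mul, neg_mul, ← zpow_add₀ hq0, ← zpow_add₀ hq0,
      show 1 - (s : ℤ) - m - t + (s + m + t - 1) = 0 by ring, zpow_zero,
      show 1 - (s : ℤ) - m - t + ((2 * (s + u) : ℕ) : ℤ) = (s : ℤ) + 1 - m + 2 * u - t by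
        push_cast; ring]
    ring
  have e3 : q ^ (((s + m + v).choose 2 : ℤ) + ((s + u : ℕ) : ℤ) ^ 2 + ((s + u : ℕ) : ℤ) -
      2 * ((s + m + v : ℕ) : ℤ) * ((s + u : ℕ) : ℤ)) * q ^ (-(2 * ((s : ℤ) + u)) * (r - 1 - v)) =
      q ^ (((s : ℤ) + u) ^ 2 + (s + u) - 2 * (s + u) * (s + m + r - 1)) *
        q ^ ((s + m + v).choose 2) := by
    rw [← zpow_natCast q ((s + m + v).choose 2), ← zpow_add₀ hq0, ← zpow_add₀ hq0]
    congr 1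
    push_cast
    ring
  rw [newtonCoeff, e1, e2, zpow_natCast]
  linear_combination ((-1) ^ (s + u) * poch q (s + m + v + 1) *
    invPoch (q ^ 2) ((m : ℤ) - u + r - 1) * invPoch q ((s : ℤ) + 1 - m + 2 * u) *
    (∏ t ∈ range v, -q ^ (1 - (s : ℤ) - m - t)) *
    (∏ t ∈ range v, (q ^ (2 * (s + u)) - q ^ ((s : ℤ) + m + t - 1))) *
    ∏ t ∈ Ico (v + 1) r, (q ^ (2 * (s + u)) - q ^ (2 * (s + m + t)))) * e3

lemma zpow_injective_of_one_sub_ne_zero {K : Type*} [Field K] {q : K} (hq0 : q ≠ 0)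
    (hq : ∀ k : ℕ, 1 - q ^ (k + 1) ≠ 0) : Function.Injective fun a : ℤ => q ^ a := by
  have key : ∀ a b : ℤ, a < b → q ^ a ≠ q ^ b := by
    intro a b hab h
    obtain ⟨k, rfl⟩ : ∃ k : ℕ, b = a + (k + 1 : ℕ) := ⟨(b - a - 1).toNat, by omega⟩
    rw [zpow_add₀ hq0, zpow_natCast] at h
    apply hq k
    rw [sub_eq_zero]
    exact mul_left_cancel₀ (zpow_ne_zero a hq0) (by rw [← h, mul_one])
  intro a b h
  rcases lt_trichotomy a b with h1 | h1 | h1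
  · exact absurd h (key _ _ h1)
  · exact h1
  · exact absurd h.symm (key _ _ h1)

/-- The determinant of the matrix of Newton coefficients that belongs to a staircase minus
a rectangle. -/
lemma det_newtonCoeff {K : Type*} [Field K] {q : K} (hq0 : q ≠ 0)
    (hq : ∀ k : ℕ, 1 - q ^ (k + 1) ≠ 0) (s m r : ℕ) :
    (Matrix.of fun k j : Fin (s + r) =>
      newtonCoeff q ((k : ℕ) : ℤ) ((j : ℕ) + if (j : ℕ) < s then 0 else m)).det =
      (∏ k ∈ range s, (-1) ^ k * q ^ ((k.choose 2 : ℤ) + k - k ^ 2)) *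
      ((∏ u ∈ range r, ((-1) ^ (s + u) *
        q ^ (((s : ℤ) + u) ^ 2 + (s + u) - 2 * (s + u) * (s + m + r - 1)) *
        invPoch (q ^ 2) ((m : ℤ) - u + r - 1) * invPoch q ((s : ℤ) + 1 - m + 2 * u))) *
      ((∏ v ∈ range r, (q ^ ((s + m + v).choose 2) * poch q (s + m + v + 1) *
        ∏ t ∈ range v, -q ^ (1 - (s : ℤ) - m - t))) *
      ∏ j ∈ range r, ∏ i ∈ range j, ((q ^ (2 * (s + j)) - q ^ (2 * (s + i))) *
        (q ^ ((s : ℤ) + m + i - 1) - q ^ (2 * (s + m + j)))))) := by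
  rw [← Matrix.det_submatrix_equiv_self finSumFinEquiv]
  set D := (Matrix.of fun k j : Fin (s + r) =>
    newtonCoeff q ((k : ℕ) : ℤ) ((j : ℕ) + if (j : ℕ) < s then 0 else m)).submatrix
      finSumFinEquiv finSumFinEquiv with hD
  -- The first `s` columns have `c = j < s`, below every row index of this block.
  have h21 : D.toBlocks₂₁ = 0 := by
    ext i j
    simp only [hD, Matrix.toBlocks₂₁, Matrix.of_apply, Matrix.submatrix_apply,
      finSumFinEquiv_apply_left, finSumFinEquiv_apply_right, Fin.val_castAdd, Fin.val_natAdd,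
      j.2, if_true, add_zero, Matrix.zero_apply]
    have := j.2
    exact newtonCoeff_of_lt q (by omega)
  have h11 : D.toBlocks₁₁.det = ∏ k ∈ range s, (-1) ^ k * q ^ ((k.choose 2 : ℤ) + k - k ^ 2) := by
    rw [Matrix.det_of_isUpperTriangular, ← Fin.prod_univ_eq_prod_range]
    · refine prod_congr rfl fun i _ => ?_
      simp only [hD, Matrix.toBlocks₁₁, Matrix.of_apply, Matrix.submatrix_apply,
        finSumFinEquiv_apply_left, Fin.val_castAdd, i.2, if_true, add_zero]
      exact newtonCoeff_self hq i
    · intro i j hij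
      have : (j : ℕ) < i := hij
      simp only [hD, Matrix.toBlocks₁₁, Matrix.of_apply, Matrix.submatrix_apply,
        finSumFinEquiv_apply_left, Fin.val_castAdd, j.2, if_true, add_zero]
      exact newtonCoeff_of_lt q (by omega)
  have ha : Function.Injective fun t : ℕ => q ^ ((s : ℤ) + m + t - 1) := fun t t' h => by
    have := zpow_injective_of_one_sub_ne_zero hq0 hq h
    omega
  have h22 : D.toBlocks₂₂ = Matrix.of fun u v : Fin r =>
      ((-1) ^ (s + (u : ℕ)) *
        q ^ (((s : ℤ) + (u : ℕ)) ^ 2 + (s + (u : ℕ)) - 2 * (s + (u : ℕ)) * (s + m + r - 1)) *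
        invPoch (q ^ 2) ((m : ℤ) - (u : ℕ) + r - 1) * invPoch q ((s : ℤ) + 1 - m + 2 * (u : ℕ))) *
      (Matrix.of fun u v : Fin r => (q ^ ((s + m + (v : ℕ)).choose 2) * poch q (s + m + v + 1) *
        ∏ t ∈ range v, -q ^ (1 - (s : ℤ) - m - t)) *
      (Matrix.of fun u v : Fin r => (∏ t ∈ range v,
        (q ^ (2 * (s + (u : ℕ))) - q ^ ((s : ℤ) + m + t - 1))) *
        ∏ t ∈ Ico ((v : ℕ) + 1) r, (q ^ (2 * (s + (u : ℕ))) - q ^ (2 * (s + m + t)))) u v) u v := by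
    ext u v
    simp only [hD, Matrix.toBlocks₂₂, Matrix.of_apply, Matrix.submatrix_apply,
      finSumFinEquiv_apply_right, Fin.val_natAdd]
    rw [if_neg (by omega), show s + (v : ℕ) + m = s + m + v by ring,
      newtonCoeff_eq_mul hq0 hq s m r u v v.2]
  rw [← Matrix.fromBlocks_toBlocks D, h21, Matrix.det_fromBlocks_zero₂₁, h11, h22,
    Matrix.det_mul_column, Matrix.det_mul_row,
    det_prod_sub_mul_prod_sub r (fun u => q ^ (2 * (s + u))) (fun t => q ^ ((s : ℤ) + m + t - 1))
      (fun t => q ^ (2 * (s + m + t))) ha,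
    Fin.prod_univ_eq_prod_range (fun u => (-1) ^ (s + u) *
        q ^ (((s : ℤ) + u) ^ 2 + (s + u) - 2 * (s + u) * (s + m + r - 1)) *
        invPoch (q ^ 2) ((m : ℤ) - u + r - 1) * invPoch q ((s : ℤ) + 1 - m + 2 * u)),
    Fin.prod_univ_eq_prod_range (fun v => q ^ ((s + m + v).choose 2) * poch q (s + m + v + 1) *
        ∏ t ∈ range v, -q ^ (1 - (s : ℤ) - m - t))]

/-! ### Evaluating the products and collecting the exponents of `q`. -/

lemma two_mul_choose_two_cast (a : ℕ) : 2 * (a.choose 2 : ℤ) = a * (a - 1) := by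
  induction a with
  | zero => simp
  | succ a ih =>
    rw [Nat.choose_succ_succ' a 1, Nat.choose_one_right]
    push_cast
    linarith

lemma six_mul_choose_three_cast (a : ℕ) : 6 * ((a + 1).choose 3 : ℤ) = (a + 1) * a * (a - 1) := by
  induction a with
  | zero => simp [Nat.choose_eq_zero_of_lt]
  | succ a ih =>
    have h := two_mul_choose_two_cast (a + 1)
    rw [Nat.choose_succ_succ' (a + 1) 2]
    push_cast at h ⊢
    linear_combination ih + 3 * h

lemma prod_zpow_eq_zpow_sum {K ι : Type*} [Field K] {q : K} (hq0 : q ≠ 0) (s : Finset ι)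
    (f : ι → ℤ) : ∏ i ∈ s, q ^ f i = q ^ ∑ i ∈ s, f i := by
  induction s using Finset.cons_induction with
  | empty => simp
  | cons a s ha ih => rw [prod_cons, sum_cons, zpow_add₀ hq0, ih]

lemma prod_range_pow {K : Type*} [CommMonoid K] (q : K) (i : ℕ) :
    ∏ j ∈ range i, q ^ j = q ^ i.choose 2 := by
  rw [prod_pow_eq_pow_sum, sum_range_id, Nat.choose_two_right]

lemma prod_geom_sub {K : Type*} [Field K] (q y : K) (i : ℕ) :
    ∏ j ∈ range i, (y * q ^ i - y * q ^ j) = (-1) ^ i * y ^ i * q ^ i.choose 2 * poch q i := by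
  have h : ∀ j ∈ range i, y * q ^ i - y * q ^ j = -1 * y * q ^ j * (1 - q ^ (i - 1 - j + 1)) := by
    intro j hj
    have hj' := mem_range.1 hj
    have e : q ^ i = q ^ j * q ^ (i - 1 - j + 1) := by
      rw [← pow_add]
      congr 1
      omega
    rw [e]
    ring
  rw [prod_congr rfl h, prod_mul_distrib, prod_mul_distrib, prod_const, card_range, mul_pow,
    prod_range_pow, prod_range_reflect (fun k => 1 - q ^ (k + 1)), poch]

lemma prod_odd_pow_sub {K : Type*} [Field K] (q : K) (i : ℕ) :
    ∏ j ∈ range i, (q ^ (2 * i + 1) - q ^ (2 * j + 1)) =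
      (-1) ^ i * q ^ ((i : ℤ) ^ 2) * poch (q ^ 2) i := by
  have h := prod_geom_sub (q ^ 2) q i
  have e : q ^ i * (q ^ 2) ^ i.choose 2 = q ^ ((i : ℤ) ^ 2) := by
    have h2 : i + 2 * i.choose 2 = i ^ 2 := by
      have := two_mul_choose_two_cast i
      zify
      linarith
    rw [← pow_mul, ← pow_add, h2, ← zpow_natCast]
    push_cast
    rfl
  rw [mul_assoc _ (q ^ i), e] at h
  rw [← h]
  exact prod_congr rfl fun j _ => by ring

lemma prod_even_pow_sub {K : Type*} [Field K] (q : K) (s i : ℕ) :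
    ∏ j ∈ range i, (q ^ (2 * (s + i)) - q ^ (2 * (s + j))) =
      (-1) ^ i * q ^ (2 * (s : ℤ) * i + i ^ 2 - i) * poch (q ^ 2) i := by
  have h := prod_geom_sub (q ^ 2) (q ^ (2 * s)) i
  have e : (q ^ (2 * s)) ^ i * (q ^ 2) ^ i.choose 2 = q ^ (2 * (s : ℤ) * i + i ^ 2 - i) := by
    have h2 : ((2 * s * i + 2 * i.choose 2 : ℕ) : ℤ) = 2 * (s : ℤ) * i + i ^ 2 - i := by
      have := two_mul_choose_two_cast i
      push_cast
      linarith
    rw [← pow_mul, ← pow_mul, ← pow_add, ← h2, zpow_natCast]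
  rw [mul_assoc _ ((q ^ (2 * s)) ^ i), e] at h
  rw [← h]
  exact prod_congr rfl fun j _ => by ring

/-- Each pair of factors contributes `-(1 - q ^ (g + 2 * v + 1 - t))`; read backwards, these extend
the Pochhammer symbol from `g + v + 1` to `g + 2 * v + 1`. -/
lemma poch_mul_prod {K : Type*} [Field K] {q : K} (hq0 : q ≠ 0) (g v : ℕ) :
    poch q (g + v + 1) * (∏ t ∈ range v, -q ^ (1 - (g : ℤ) - t)) *
      ∏ t ∈ range v, (q ^ ((g : ℤ) + t - 1) - q ^ (2 * (g + v))) =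
      (-1) ^ v * poch q (g + 2 * v + 1) := by
  have h : ∀ t ∈ range v, -q ^ (1 - (g : ℤ) - t) * (q ^ ((g : ℤ) + t - 1) - q ^ (2 * (g + v))) =
      -1 * (1 - q ^ (g + v + 1 + (v - 1 - t) + 1)) := by
    intro t ht
    have ht' := mem_range.1 ht
    have e1 : q ^ (1 - (g : ℤ) - t) * q ^ ((g : ℤ) + t - 1) = 1 := by
      rw [← zpow_add₀ hq0, ← zpow_zero q]
      congr 1
      ring
    have e2 : q ^ (1 - (g : ℤ) - t) * q ^ (2 * (g + v)) = q ^ (g + v + 1 + (v - 1 - t) + 1) := by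
      rw [← zpow_natCast, ← zpow_natCast, ← zpow_add₀ hq0]
      congr 1
      omega
    linear_combination e2 - e1
  rw [mul_assoc, ← prod_mul_distrib, prod_congr rfl h, prod_mul_distrib, prod_const, card_range,
    prod_range_reflect (fun t => 1 - q ^ (g + v + 1 + t + 1)),
    show g + 2 * v + 1 = g + v + 1 + v by ring]
  simp only [poch]
  rw [prod_range_add _ (g + v + 1) v]
  ring

/-- The summand contains `r`, so the upper limit `R` is kept separate to make induction possible;
the factor 12 clears denominators. -/
lemma sum_exponents (s g r R : ℕ) :
    (12 : ℤ) * ∑ u ∈ range R, (2 * ((s : ℤ) + u) ^ 2 + (s + u) - 2 * (s + u) * (g + r - 1) +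
      ((g + u).choose 2 : ℤ) + 2 * s * u + u ^ 2 - u) =
      7 * (R : ℤ) * (R - 1) * (2 * R - 1) +
        (36 * (s : ℤ) - 6 * g - 12 * r + 9) * R * (R - 1) +
        12 * R * (2 * (s : ℤ) ^ 2 + s - 2 * s * (g + r - 1)) + 6 * R * ((g : ℤ) ^ 2 - g) := by
  induction R with
  | zero => simp
  | succ R ih =>
    have h := two_mul_choose_two_cast (g + R)
    rw [sum_range_succ, mul_add, ih]
    push_cast at h ⊢
    linear_combination 6 * h

lemma sum_range_choose_two (s : ℕ) :
    ∑ i ∈ range s, ((i : ℤ) ^ 2 + ((i.choose 2 : ℤ) + i - i ^ 2)) = (s + 1).choose 3 := by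
  induction s with
  | zero => simp [Nat.choose_eq_zero_of_lt]
  | succ s ih =>
    rw [sum_range_succ, ih, Nat.choose_succ_succ' (s + 1) 2, Nat.choose_succ_succ' s 1,
      Nat.choose_one_right]
    push_cast
    ring

lemma total_exponent (s m r : ℕ) :
    (∑ i ∈ range s, ((i : ℤ) ^ 2 + ((i.choose 2 : ℤ) + i - i ^ 2))) +
      ∑ u ∈ range r, (2 * ((s : ℤ) + u) ^ 2 + (s + u) - 2 * (s + u) * ((s + m : ℕ) + r - 1) +
        ((s + m + u).choose 2 : ℤ) + 2 * s * u + u ^ 2 - u) =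
      ((m : ℤ) * r * (r + m - 2 * (s + r : ℕ))) / 2 + ((s + r + 1).choose 3 : ℤ) := by
  have h1 := six_mul_choose_three_cast s
  have h2 := six_mul_choose_three_cast (s + r)
  have h3 := sum_exponents s (s + m) r r
  -- Integer division by 2 is exact: if `m` and `r` are both odd, the last factor is even.
  obtain ⟨w, hw⟩ : ∃ w : ℤ, (m : ℤ) * r * (r + m - 2 * (s + r : ℕ)) = 2 * w := by
    rcases Int.even_or_odd' (m : ℤ) with ⟨a, ha | ha⟩ <;>
      rcases Int.even_or_odd' (r : ℤ) with ⟨b, hb | hb⟩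
    · exact ⟨a * r * (r + m - 2 * (s + r : ℕ)), by rw [ha]; ring⟩
    · exact ⟨a * r * (r + m - 2 * (s + r : ℕ)), by rw [ha]; ring⟩
    · exact ⟨m * b * (r + m - 2 * (s + r : ℕ)), by rw [hb]; ring⟩
    · exact ⟨m * r * (a + b + 1 - (s + r : ℕ)), by
        linear_combination (m : ℤ) * r * ha + (m : ℤ) * r * hb⟩
  rw [hw, Int.mul_ediv_cancel_left _ two_ne_zero, sum_range_choose_two]
  push_cast at h1 h2 h3 hw ⊢
  linarith

/-- The determinant for the staircase minus a rectangle in product form. -/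
lemma det_staircase {K : Type*} [Field K] {q : K} (hq0 : q ≠ 0)
    (hq : ∀ k : ℕ, 1 - q ^ (k + 1) ≠ 0) (s m r : ℕ) (hm : m ≤ s + 1) :
    (Matrix.of fun i j : Fin (s + r) => invPoch q
      (2 * (i : ℤ) + 1 - (((j : ℕ) + if (j : ℕ) < s then 0 else m : ℕ) : ℤ))).det =
      q ^ (((m : ℤ) * r * (r + m - 2 * (s + r : ℕ))) / 2 + ((s + r + 1).choose 3 : ℤ)) *
      (∏ i ∈ range (s + r), poch (q ^ 2) i / poch q (2 * i + 1)) *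
      ∏ u ∈ range r, (poch (q ^ 2) u * poch q (s + m + 2 * u + 1)) /
        (poch (q ^ 2) (m + u) * poch q (s + 1 - m + 2 * u)) := by
  rw [det_invPoch_eq_mul_det_newtonCoeff hq0 hq (s + r)
    (fun j => (j : ℕ) + if (j : ℕ) < s then 0 else m), det_newtonCoeff hq0 hq]
  have hsign : ∀ i : ℕ, ((-1 : K) ^ i) * (-1) ^ i = 1 := fun i => by
    rw [← mul_pow]; simp
  have hC : (∏ v ∈ range r, (q ^ ((s + m + v).choose 2) * poch q (s + m + v + 1) *
        ∏ t ∈ range v, -q ^ (1 - (s : ℤ) - m - t))) *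
      (∏ j ∈ range r, ∏ i ∈ range j, ((q ^ (2 * (s + j)) - q ^ (2 * (s + i))) *
        (q ^ ((s : ℤ) + m + i - 1) - q ^ (2 * (s + m + j))))) =
      ∏ v ∈ range r, (q ^ (((s + m + v).choose 2 : ℤ) + (2 * s * v + v ^ 2 - v)) *
        poch (q ^ 2) v * poch q (s + m + 2 * v + 1)) := by
    rw [← prod_mul_distrib]
    refine prod_congr rfl fun v _ => ?_
    have h1 := poch_mul_prod hq0 (s + m) v
    have e : ∀ t : ℕ, 1 - (((s + m : ℕ) : ℤ)) - t = 1 - (s : ℤ) - m - t := fun t => by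
      push_cast; ring
    simp only [e] at h1
    push_cast at h1
    rw [prod_mul_distrib, prod_even_pow_sub, zpow_add₀ hq0, zpow_natCast]
    linear_combination (q ^ ((s + m + v).choose 2) * ((-1) ^ v *
      q ^ (2 * (s : ℤ) * v + v ^ 2 - v) * poch (q ^ 2) v)) * h1 +
      (q ^ ((s + m + v).choose 2) * q ^ (2 * (s : ℤ) * v + v ^ 2 - v) * poch (q ^ 2) v *
        poch q (s + m + 2 * v + 1)) * hsign v
  have hR : ∏ u ∈ range r, ((-1) ^ (s + u) *
        q ^ (((s : ℤ) + u) ^ 2 + (s + u) - 2 * (s + u) * (s + m + r - 1)) *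
        invPoch (q ^ 2) ((m : ℤ) - u + r - 1) * invPoch q ((s : ℤ) + 1 - m + 2 * u)) =
      ∏ u ∈ range r, ((-1) ^ (s + u) *
        q ^ (((s : ℤ) + u) ^ 2 + (s + u) - 2 * (s + u) * (s + m + r - 1)) *
        (poch (q ^ 2) (m + u))⁻¹ * (poch q (s + 1 - m + 2 * u))⁻¹) := by
    -- Reversing the order `u ↦ r - 1 - u` turns the argument into `m + u`.
    have e1 : ∏ u ∈ range r, invPoch (q ^ 2) ((m : ℤ) - u + r - 1) =
        ∏ u ∈ range r, (poch (q ^ 2) (m + u))⁻¹ := by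
      rw [← prod_range_reflect]
      refine prod_congr rfl fun u hu => ?_
      have := mem_range.1 hu
      rw [← invPoch_natCast]
      congr 1
      omega
    have e2 : ∀ u : ℕ, invPoch q ((s : ℤ) + 1 - m + 2 * u) = (poch q (s + 1 - m + 2 * u))⁻¹ := by
      intro u
      rw [← invPoch_natCast]
      congr 1
      omega
    simp only [e2]
    rw [prod_mul_distrib, prod_mul_distrib, e1, ← prod_mul_distrib, ← prod_mul_distrib]
  have hV : ∏ i ∈ range (s + r), ∏ j ∈ range i, (q ^ (2 * i + 1) - q ^ (2 * j + 1)) =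
      (∏ i ∈ range s, ((-1) ^ i * q ^ ((i : ℤ) ^ 2))) *
      (∏ u ∈ range r, ((-1) ^ (s + u) * q ^ (((s : ℤ) + u) ^ 2))) *
      ∏ i ∈ range (s + r), poch (q ^ 2) i := by
    simp only [prod_odd_pow_sub]
    rw [prod_mul_distrib, prod_range_add _ s r]
    push_cast
    rfl
  have hA : (∏ i ∈ range s, ((-1) ^ i * q ^ ((i : ℤ) ^ 2))) *
      (∏ k ∈ range s, (-1) ^ k * q ^ ((k.choose 2 : ℤ) + k - k ^ 2)) =
      q ^ ∑ i ∈ range s, ((i : ℤ) ^ 2 + ((i.choose 2 : ℤ) + i - i ^ 2)) := by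
    rw [← prod_zpow_eq_zpow_sum hq0, ← prod_mul_distrib]
    refine prod_congr rfl fun i _ => ?_
    rw [zpow_add₀ hq0]
    linear_combination (q ^ ((i : ℤ) ^ 2) * q ^ ((i.choose 2 : ℤ) + i - i ^ 2)) * hsign i
  have hB : (∏ u ∈ range r, ((-1) ^ (s + u) * q ^ (((s : ℤ) + u) ^ 2))) *
      ((∏ u ∈ range r, ((-1) ^ (s + u) *
        q ^ (((s : ℤ) + u) ^ 2 + (s + u) - 2 * (s + u) * (s + m + r - 1)) *
        (poch (q ^ 2) (m + u))⁻¹ * (poch q (s + 1 - m + 2 * u))⁻¹)) *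
      ∏ v ∈ range r, (q ^ (((s + m + v).choose 2 : ℤ) + (2 * s * v + v ^ 2 - v)) *
        poch (q ^ 2) v * poch q (s + m + 2 * v + 1))) =
      q ^ (∑ u ∈ range r, (2 * ((s : ℤ) + u) ^ 2 + (s + u) - 2 * (s + u) * ((s + m : ℕ) + r - 1) +
        ((s + m + u).choose 2 : ℤ) + 2 * s * u + u ^ 2 - u)) *
      ∏ u ∈ range r, (poch (q ^ 2) u * poch q (s + m + 2 * u + 1)) /
        (poch (q ^ 2) (m + u) * poch q (s + 1 - m + 2 * u)) := by
    rw [← prod_zpow_eq_zpow_sum hq0, ← prod_mul_distrib, ← prod_mul_distrib, ← prod_mul_distrib]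
    refine prod_congr rfl fun u _ => ?_
    have e : q ^ (2 * ((s : ℤ) + u) ^ 2 + (s + u) - 2 * (s + u) * ((s + m : ℕ) + r - 1) +
        ((s + m + u).choose 2 : ℤ) + 2 * s * u + u ^ 2 - u) =
        q ^ (((s : ℤ) + u) ^ 2) *
        q ^ (((s : ℤ) + u) ^ 2 + (s + u) - 2 * (s + u) * (s + m + r - 1)) *
        q ^ (((s + m + u).choose 2 : ℤ) + (2 * s * u + u ^ 2 - u)) := by
      rw [← zpow_add₀ hq0, ← zpow_add₀ hq0]
      congr 1
      push_cast
      ring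
    rw [e, div_eq_mul_inv, mul_inv]
    linear_combination (q ^ (((s : ℤ) + u) ^ 2) *
        q ^ (((s : ℤ) + u) ^ 2 + (s + u) - 2 * (s + u) * (s + m + r - 1)) *
        q ^ (((s + m + u).choose 2 : ℤ) + (2 * s * u + u ^ 2 - u)) *
        poch (q ^ 2) u * poch q (s + m + 2 * u + 1) * (poch (q ^ 2) (m + u))⁻¹ *
        (poch q (s + 1 - m + 2 * u))⁻¹) * hsign (s + u)
  rw [hC, hR, hV, ← total_exponent, zpow_add₀ hq0, ← hA]
  have hD : ∏ i ∈ range (s + r), poch (q ^ 2) i / poch q (2 * i + 1) =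
      (∏ i ∈ range (s + r), poch (q ^ 2) i) * ∏ i ∈ range (s + r), (poch q (2 * i + 1))⁻¹ := by
    rw [← prod_mul_distrib]
    simp only [div_eq_mul_inv]
  rw [hD]
  linear_combination ((∏ i ∈ range (s + r), poch (q ^ 2) i) *
    (∏ i ∈ range (s + r), (poch q (2 * i + 1))⁻¹) * (∏ i ∈ range s, ((-1) ^ i * q ^ ((i : ℤ) ^ 2))) *
      (∏ k ∈ range s, (-1) ^ k * q ^ ((k.choose 2 : ℤ) + k - k ^ 2))) * hB

/-! ### From Pochhammer symbols to `q`-factorials, and the final formula. -/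

lemma poch_eq_mul_qFactorial {K : Type*} [Field K] (q : K) (a : ℕ) :
    poch q a = (1 - q) ^ a * qFactorial q a := by
  induction a with
  | zero => simp [poch, qFactorial]
  | succ a ih =>
    have h : (1 - q) * qInteger q (a + 1) = 1 - q ^ (a + 1) := mul_neg_geom_sum q (a + 1)
    have h2 : qFactorial q (a + 1) = qFactorial q a * qInteger q (a + 1) :=
      prod_Icc_succ_top (by omega) _
    rw [poch_succ, ih, h2, ← h]
    ring

lemma qFactorial_ne_zero {K : Type*} [Field K] {q : K} (hq : ∀ k : ℕ, 1 - q ^ (k + 1) ≠ 0)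
    (a : ℕ) : qFactorial q a ≠ 0 := by
  have h := poch_ne_zero hq a
  rw [poch_eq_mul_qFactorial] at h
  exact right_ne_zero_of_mul h

lemma poch_sq_eq_mul_qFactorial {K : Type*} [Field K] (q : K) (a : ℕ) :
    poch (q ^ 2) a = (1 - q) ^ a * (1 + q) ^ a * qFactorial (q ^ 2) a := by
  rw [poch_eq_mul_qFactorial, ← mul_pow]
  congr 2
  ring

lemma prod_Icc_one_eq_prod_range {M : Type*} [CommMonoid M] (f : ℕ → M) (n : ℕ) :
    ∏ i ∈ Icc 1 n, f i = ∏ i ∈ range n, f (i + 1) := by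
  rw [range_eq_Ico, prod_Ico_add' f 0 n 1]
  rfl

lemma antitone_staircase (n : ℕ) : Antitone (staircase n) := fun _ _ h =>
  Nat.sub_le_sub_left h n

lemma antitone_rectangle (n m r : ℕ) : Antitone (rectangle n m r) := fun i j h => by
  have h' : (i : ℕ) ≤ j := h
  unfold rectangle
  split_ifs <;> omega

lemma rectangle_le_staircase {n m r : ℕ} (h : m + r ≤ n + 1) :
    rectangle n m r ≤ staircase n := fun i => by
  change (if (i : ℕ) < r then m else 0) ≤ n - (i : ℕ)
  split_ifs <;> omega

lemma skewSize_staircase_rectangle {s m r : ℕ} (h : m ≤ s + 1) :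
    skewSize (staircase (s + r)) (rectangle (s + r) m r) + m * r = (s + r + 1).choose 2 := by
  have hle : rectangle (s + r) m r ≤ staircase (s + r) := rectangle_le_staircase (by omega)
  have h1 : ∑ i, rectangle (s + r) m r i = m * r := by
    unfold rectangle
    rw [Fin.sum_univ_eq_sum_range (fun i => if i < r then m else 0), ← sum_filter, sum_const,
      smul_eq_mul, mul_comm]
    congr 1
    rw [show (range (s + r)).filter (fun i => i < r) = range r by ext i; simp; omega, card_range]
  have h2 : ∑ i, staircase (s + r) i = (s + r + 1).choose 2 := by
    unfold staircase
    rw [Fin.sum_univ_eq_sum_range (fun i => s + r - i)]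
    generalize s + r = n
    rw [← Nat.sub_zero ((n + 1).choose 2), Nat.sub_zero, Nat.choose_two_right, ← sum_range_id,
      sum_range_succ', add_zero, ← sum_range_reflect]
    refine sum_congr rfl fun i hi => ?_
    have := mem_range.1 hi
    omega
  rw [← h2, ← h1, skewSize, ← sum_add_distrib]
  exact sum_congr rfl fun i _ => Nat.sub_add_cancel (hle i)

/-- Rows and columns are both reversed, which leaves the determinant unchanged and moves the
rectangle to the last `r` columns. -/
lemma det_jacobiTrudi_staircase {K : Type*} [Field K] (q : K) (s m r : ℕ) :
    (jacobiTrudi q 0 (fun i => (staircase (s + r) i : ℤ))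
      (fun i => (rectangle (s + r) m r i : ℤ))).det =
    (Matrix.of fun i j : Fin (s + r) => invPoch q
      (2 * (i : ℤ) + 1 - (((j : ℕ) + if (j : ℕ) < s then 0 else m : ℕ) : ℤ))).det := by
  rw [← Matrix.det_submatrix_equiv_self Fin.revPerm]
  congr 1
  ext i j
  simp only [jacobiTrudi, Matrix.submatrix_apply, Matrix.of_apply, Nat.not_lt_zero, if_false,
    one_mul, Fin.revPerm_apply, staircase, rectangle, Fin.val_rev]
  congr 1
  have hi := i.2
  have hj := j.2
  have hiff : s + r - ((j : ℕ) + 1) < r ↔ ¬ (j : ℕ) < s := by omega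
  simp only [hiff]
  split_ifs <;> omega

lemma sum_maj_staircase_rectangle {K : Type*} [Field K] {q : K} (hq0 : q ≠ 0)
    (hq : ∀ k : ℕ, 1 - q ^ (k + 1) ≠ 0) (n m r : ℕ) (hr : r ≤ n) (h : m + r ≤ n + 1) :
    ∑ T : SkewSYT (staircase n) (rectangle n m r), q ^ T.maj =
      q ^ (((m : ℤ) * r * (r + m - 2 * n)) / 2 + ((n + 1).choose 3 : ℤ)) *
        (1 + q) ^ ((n.choose 2 : ℤ) - m * r) *
        qFactorial q ((n + 1).choose 2 - m * r) *
        (∏ i ∈ Icc 1 n, qFactorial (q ^ 2) (i - 1) / qFactorial q (2 * i - 1)) *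
        ∏ i ∈ Icc 1 r,
          (qFactorial (q ^ 2) (i - 1) * qFactorial q (n + m + 2 * i - 1 - r)) /
            (qFactorial (q ^ 2) (m + i - 1) * qFactorial q (n + 2 * i - 1 - m - r)) := by
  obtain ⟨s, rfl⟩ : ∃ s, n = s + r := ⟨n - r, by omega⟩
  have hm : m ≤ s + 1 := by omega
  have hN := skewSize_staircase_rectangle (r := r) hm
  have h1 : 1 - q ≠ 0 := by simpa using hq 0
  have h2 : 1 + q ≠ 0 := by
    have := hq 1
    rw [show 1 - q ^ (1 + 1) = (1 - q) * (1 + q) by ring] at this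
    exact right_ne_zero_of_mul this
  rw [← majSum_zero, majSum_eq_det hq0 hq (antitone_rectangle _ m r) _ _ (antitone_staircase _)
    (rectangle_le_staircase h) rfl 0 (Nat.zero_le _), det_jacobiTrudi_staircase,
    det_staircase hq0 hq s m r hm]
  set N := skewSize (staircase (s + r)) (rectangle (s + r) m r)
  rw [show (s + r + 1).choose 2 - m * r = N by omega, prod_Icc_one_eq_prod_range,
    prod_Icc_one_eq_prod_range]
  have e1 : ∏ i ∈ range (s + r), poch (q ^ 2) i / poch q (2 * i + 1) =
      (1 + q) ^ (s + r).choose 2 / (1 - q) ^ (s + r + 1).choose 2 *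
      ∏ i ∈ range (s + r), qFactorial (q ^ 2) (i + 1 - 1) / qFactorial q (2 * (i + 1) - 1) := by
    have h3 : (1 - q) ^ (s + r + 1).choose 2 = ∏ i ∈ range (s + r), (1 - q) ^ (i + 1) := by
      rw [← prod_range_pow, prod_range_succ', pow_zero, mul_one]
    rw [← prod_range_pow, h3, ← prod_div_distrib, ← prod_mul_distrib]
    refine prod_congr rfl fun i _ => ?_
    have h4 := qFactorial_ne_zero hq (2 * i + 1)
    rw [poch_sq_eq_mul_qFactorial, poch_eq_mul_qFactorial, Nat.add_sub_cancel,
      show 2 * (i + 1) - 1 = 2 * i + 1 by omega]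
    field_simp
    ring
  have e2 : ∏ u ∈ range r, (poch (q ^ 2) u * poch q (s + m + 2 * u + 1)) /
        (poch (q ^ 2) (m + u) * poch q (s + 1 - m + 2 * u)) =
      (1 - q) ^ (m * r) / (1 + q) ^ (m * r) *
      ∏ i ∈ range r, (qFactorial (q ^ 2) (i + 1 - 1) *
        qFactorial q (s + r + m + 2 * (i + 1) - 1 - r)) /
        (qFactorial (q ^ 2) (m + (i + 1) - 1) *
          qFactorial q (s + r + 2 * (i + 1) - 1 - m - r)) := by
    have h3 : (1 - q) ^ (m * r) / (1 + q) ^ (m * r) =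
        ∏ _i ∈ range r, (1 - q) ^ m / (1 + q) ^ m := by
      rw [prod_const, card_range, div_pow, ← pow_mul, ← pow_mul]
    rw [h3, ← prod_mul_distrib]
    refine prod_congr rfl fun u _ => ?_
    have h4 := qFactorial_ne_zero (one_sub_sq_pow_ne_zero hq) (m + u)
    have h5 := qFactorial_ne_zero hq (s + 1 - m + 2 * u)
    obtain ⟨p, hp⟩ : ∃ p, s + 1 = m + p := ⟨s + 1 - m, by omega⟩
    rw [show s + r + m + 2 * (u + 1) - 1 - r = s + m + 2 * u + 1 by omega,
      show m + (u + 1) - 1 = m + u by omega, Nat.add_sub_cancel,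
      show s + r + 2 * (u + 1) - 1 - m - r = s + 1 - m + 2 * u by omega,
      poch_sq_eq_mul_qFactorial, poch_sq_eq_mul_qFactorial, poch_eq_mul_qFactorial,
      poch_eq_mul_qFactorial]
    rw [show s + 1 - m + 2 * u = p + 2 * u by omega] at h5 ⊢
    have h6 : (1 - q) ^ (s + m + 2 * u + 1) = (1 - q) ^ (m + m + p + 2 * u) := by
      congr 1
      omega
    rw [h6]
    field_simp
    ring
  have e3 : (1 + q) ^ (((s + r).choose 2 : ℤ) - m * r) =
      (1 + q) ^ (s + r).choose 2 / (1 + q) ^ (m * r) := by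
    rw [zpow_sub₀ h2, zpow_natCast, ← Nat.cast_mul, zpow_natCast]
  -- All powers of `1 - q` cancel because `N + m * r = (s + r + 1).choose 2`.
  rw [e1, e2, e3, poch_eq_mul_qFactorial, ← hN]
  field_simp
  ring

lemma RatFunc.one_sub_X_pow_ne_zero (k : ℕ) : 1 - (RatFunc.X : RatFunc ℚ) ^ (k + 1) ≠ 0 := by
  rw [← RatFunc.algebraMap_X, ← map_pow, ← map_one (algebraMap (Polynomial ℚ) (RatFunc ℚ)),
    ← map_sub]
  refine RatFunc.algebraMap_ne_zero fun h0 => ?_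
  have := congrArg (Polynomial.eval 0) h0
  simp at this

theorem mainTheorem4 (n m r : ℕ) (h : m + r ≤ n + 1) (q : RatFunc ℚ) (hq : q = RatFunc.X) :
    ∑ T : SkewSYT (staircase n) (rectangle n m r), q ^ T.maj =
      q ^ (((m : ℤ) * r * (r + m - 2 * n)) / 2 + ((n + 1).choose 3 : ℤ)) *
        (1 + q) ^ ((n.choose 2 : ℤ) - m * r) *
        qFactorial q ((n + 1).choose 2 - m * r) *
        (∏ i ∈ Icc 1 n, qFactorial (q ^ 2) (i - 1) / qFactorial q (2 * i - 1)) *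
        ∏ i ∈ Icc 1 r,
          (qFactorial (q ^ 2) (i - 1) * qFactorial q (n + m + 2 * i - 1 - r)) /
            (qFactorial (q ^ 2) (m + i - 1) * qFactorial q (n + 2 * i - 1 - m - r)) := by
  have hq0 : q ≠ 0 := hq ▸ RatFunc.X_ne_zero
  have hq1 : ∀ k : ℕ, 1 - q ^ (k + 1) ≠ 0 := hq ▸ RatFunc.one_sub_X_pow_ne_zero
  by_cases hr : r ≤ n
  · exact sum_maj_staircase_rectangle hq0 hq1 n m r hr h
  -- Only `r = n + 1` is left: the rectangle is empty, and each factor of the last product is a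
  -- quotient of equal terms.
  · obtain rfl : m = 0 := by omega
    have hrect : rectangle n 0 r = rectangle n 0 0 := by
      funext i
      simp [rectangle]
    have hprod : ∏ i ∈ Icc 1 r,
        (qFactorial (q ^ 2) (i - 1) * qFactorial q (n + 0 + 2 * i - 1 - r)) /
          (qFactorial (q ^ 2) (0 + i - 1) * qFactorial q (n + 2 * i - 1 - 0 - r)) = 1 := by
      refine prod_eq_one fun i _ => ?_
      rw [add_zero, zero_add, Nat.sub_zero]
      exact div_self (mul_ne_zero (qFactorial_ne_zero (one_sub_sq_pow_ne_zero hq1) _)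
        (qFactorial_ne_zero hq1 _))
    rw [hprod, hrect, sum_maj_staircase_rectangle hq0 hq1 n 0 0 (Nat.zero_le _) (by omega)]
    simp
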